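/- **First Residue Vanishing Theorem.** Let $k,m,r$ be non-negative integers with $k\le m\le r$ and $r(k-1)\le (m-1)k$ (for $k\ge 2$: $r\le (m-1)\frac{k}{k-1}$), let $d\ge 0$, and let $\lambda_1,\dots,\lambda_m,\theta_1,\dots,\theta_r\in\mathbb C$ be parameters. Let $T=(\mathbb C^*)^k$ act diagonally on $\mathbb C^k$, with weights $z_1,\dots,z_k$ on the basis $e_1,\dots,e_k$. Let $\widehat N_{\mathbf f}$ be the fibre over the standard flag of the balanced fully nested Hilbert scheme of points labelled $0,\dots,k$: the closure in $\prod_{A\subseteq\{0,\dots,k\}}\mathrm{Hilb}^{|A|}(\mathbb C^k)$ of the set of all $(\{p_j: j\in A\})_A$, where $p_0,\dots,p_k\in\mathbb C^k$ are affinely independent, $p_0+\dots+p_k=0$, and $p_j-p_0\in\mathrm{Span}(e_1,\dots,e_j)$ for all $j$. Let $\pi:\mathbf{BN}_{\mathbf f}\to\widehat N_{\mathbf f}$ be any $T$-equivariant nonsingular resolution (a complex manifold with a holomorphic $T$-action and a proper, surjective, birational, equivariant holomorphic map to $\widehat N_{\mathbf f}$). Let $F\in\mathbf{BN}_{\mathbf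 f}$ be an isolated $T$-fixed point, write $\pi(F)=(\xi_A)_A$, and let $\mathrm{Euler}_F(\mathbf{BN}_{\mathbf f})$ be the product of the weights, as linear forms in $z_1,\dots,z_k$ and with multiplicity, of $T$ on the tangent space $T_F\mathbf{BN}_{\mathbf f}$. Let $\alpha=(\alpha_1,\dots,\alpha_s)$ be a partition of the set of $k+1$ labels with $s>1$ blocks. Let $c_{d,F}(V^\alpha)$ be the $d$-th equivariant Chern class at $F$ of $V^\alpha=\bigoplus_{i=1}^s V\otimes\mathcal O^{[\alpha_i]}$, where $V$ has equivariant Chern roots $\theta_1,\dots,\theta_r$. That is, $c_{d,F}(V^\alpha)$ is the $d$-th elementary symmetric polynomial of all sums $\theta_\ell+\sum_j a_jz_j$, for $1\le \ell\le r$, $1\le i\le s$, and $x^a$ running over the $|\alpha_i|$ monomials not in the ($T$-fixed, hence monomial) ideal of $\xi_{\alpha_i}$. Then $$\operatorname*{Res}_{\mathbf z=\infty}\ \frac{\prod_{1\le i<j\le k}(z_i-z_j)\; c_{d,F}(V^\alpha)}{\mathrm{Euler}_F(\mathbf{BN}_{\mathbf f})\,\prod_{l=1}^k\prod_{i=1}^m(\lambda_i-z_l)}\;d\mathbf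 z\;=\;0 .$$ Here $\operatorname{Res}_{\mathbf z=\infty}=\operatorname{Res}_{z_1=\infty}\cdots\operatorname{Res}_{z_k=\infty}$ is the iterated residue: $(2\pi i)^{-k}$ times the integral over the torus $|z_i|=R_i$ with $1\ll R_1\ll\dots\ll R_k$, oriented so that $d\mathbf z/(z_1\cdots z_k)$ has residue $(-1)^k$. -/

import Mathlib

open scoped Manifold ContDiff Topology

noncomputable section

namespace NestedHilbert

/-! ### Points, ideals and the Hilbert scheme of points of affine space -/

/-- The coordinate ring of the affine space `ℂ^k`. -/
abbrev CoordRing (k : ℕ) : Type := MvPolynomial (Fin k) ℂ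

/-- The torus `(ℂˣ)^k`, acting on `ℂ^k` diagonally; `z₁, …, z_k` are the weights of the basis
vectors `e₁, …, e_k`. -/
abbrev Torus (k : ℕ) : Type := Fin k → ℂˣ

/-- The closed points of the Hilbert scheme of `n` points of `ℂ^k`: ideals of colength `n`. -/
def HilbPt (k n : ℕ) : Type :=
  {I : Ideal (CoordRing k) //
    Module.Finite ℂ (CoordRing k ⧸ I) ∧ Module.finrank ℂ (CoordRing k ⧸ I) = n}

/-- The class of the monomial `x^a` in the quotient by `I`. -/
def monClass {k : ℕ} (I : Ideal (CoordRing k)) (a : Fin k →₀ ℕ) : CoordRing k ⧸ I :=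
  Ideal.Quotient.mk I (MvPolynomial.monomial a 1)

/-- The standard affine chart of the Hilbert scheme attached to a finite set `B` of monomials:
the ideals `I` such that `B` is a basis of the quotient by `I`. -/
def HilbChart {k : ℕ} (B : Finset (Fin k →₀ ℕ)) : Set (Ideal (CoordRing k)) :=
  {I | LinearIndependent ℂ (fun b : B => monClass I b) ∧
    ⊤ ≤ Submodule.span ℂ (Set.range (fun b : B => monClass I b))}

open Classical in
/-- The coordinates on the chart of `B`: the coefficient of `x^b` in the expansion of `x^a` in the
basis `B` of the quotient by `I` (and `0` outside the chart). -/
def hilbCoord {k : ℕ} (B : Finset (Fin k →₀ ℕ)) (a : Fin k →₀ ℕ) (b : B)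
    (I : Ideal (CoordRing k)) : ℂ :=
  if h : I ∈ HilbChart B then (Module.Basis.mk h.1 h.2).repr (monClass I a) b else 0

/-- The classical (analytic) topology of the Hilbert scheme: the charts are open and carry the
topology given by their coordinates. -/
instance (k n : ℕ) : TopologicalSpace (HilbPt k n) :=
  TopologicalSpace.generateFrom
    {S | ∃ (B : Finset (Fin k →₀ ℕ)) (a : Fin k →₀ ℕ) (b : B) (O : Set ℂ), IsOpen O ∧
      S = {I : HilbPt k n | I.1 ∈ HilbChart B ∧ hilbCoord B a b I.1 ∈ O}}

/-- A map from a complex manifold to the Hilbert scheme of points is holomorphic if near every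
point it takes values in one chart and has holomorphic coordinates there. -/
def IsHolomorphicFamily {k n : ℕ} {E : Type*} [NormedAddCommGroup E] [NormedSpace ℂ E]
    {M : Type*} [TopologicalSpace M] [ChartedSpace E M] (J : M → HilbPt k n) : Prop :=
  ∀ x₀ : M, ∃ B : Finset (Fin k →₀ ℕ), ∃ U ∈ 𝓝 x₀,
    (∀ x ∈ U, (J x).1 ∈ HilbChart B) ∧
    ∀ (a : Fin k →₀ ℕ) (b : B),
      ContMDiffOn 𝓘(ℂ, E) 𝓘(ℂ) ω (fun x => hilbCoord B a b (J x).1) U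

/-- Substitution `f(x) ↦ f(t x)` for a torus element `t`. -/
def scale {k : ℕ} (t : Torus k) : CoordRing k →ₐ[ℂ] CoordRing k :=
  MvPolynomial.aeval (fun i => MvPolynomial.C (t i : ℂ) * MvPolynomial.X i)

/-- The ideal of the translate `t ξ` of the subscheme `ξ` with ideal `I`. -/
def translateIdeal {k : ℕ} (t : Torus k) (I : Ideal (CoordRing k)) : Ideal (CoordRing k) :=
  I.comap (scale t)

/-! ### The fibre of the balanced fully nested Hilbert scheme over the standard flag -/

/-- Balanced configurations `(p₀, …, p_k)` of `k + 1` points of `ℂ^k` adapted to the standard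
flag: the barycentre is the origin, and `p_j - p₀` lies in `Span(e₁, …, e_j)` for every `j`. -/
def FlaggedConfig (k : ℕ) : Submodule ℂ (Fin (k + 1) → Fin k → ℂ) where
  carrier := {p | ∑ j, p j = 0 ∧
    ∀ (j : Fin (k + 1)) (i : Fin k), (j : ℕ) ≤ (i : ℕ) → p j i = p 0 i}
  add_mem' := by
    rintro p q ⟨hp, hp'⟩ ⟨hq, hq'⟩
    refine ⟨?_, fun j i h => ?_⟩
    · simp [Finset.sum_add_distrib, hp, hq]
    · simp [hp' j i h, hq' j i h]
  zero_mem' := by simp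
  smul_mem' := by
    rintro c p ⟨hp, hp'⟩
    refine ⟨?_, fun j i h => ?_⟩
    · simp [← Finset.smul_sum, hp]
    · simp [hp' j i h]

/-- The product of the Hilbert schemes of the subsets `A` of the labels `{0, …, k}`. -/
abbrev NestedProduct (k : ℕ) : Type := (A : Finset (Fin (k + 1))) → HilbPt k A.card

/-- `ξ` is the point of the product of Hilbert schemes given by the configuration `p` of points:
its `A`-component is the reduced subscheme `{p_j : j ∈ A}`. -/
def IsConfigPoint {k : ℕ} (p : Fin (k + 1) → Fin k → ℂ) (ξ : NestedProduct k) : Prop :=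
  ∀ A : Finset (Fin (k + 1)),
    (ξ A).1 = MvPolynomial.vanishingIdeal ℂ (p '' (A : Set (Fin (k + 1))))

/-- The fibre over the standard flag of the balanced fully nested Hilbert scheme: the closure of
the locus of `k + 1` affinely independent points with barycentre at the origin whose first
`j + 1` points span an affine space of direction `Span(e₁, …, e_j)` for every `j`. -/
def flagFibre (k : ℕ) : Set (NestedProduct k) :=
  closure {ξ | ∃ p ∈ FlaggedConfig k, AffineIndependent ℂ p ∧ IsConfigPoint p ξ}

/-- The torus element `exp(s)`. -/
def expTorus {k : ℕ} (s : Fin k → ℂ) : Torus k :=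
  fun i => Units.mk0 (Complex.exp (s i)) (Complex.exp_ne_zero _)

/-- Torus-equivariant nonsingular resolutions `π` of `flagFibre k` by a complex manifold `M` with
an action of `(ℂˣ)^k`. -/
structure IsEquivariantResolution {k : ℕ} (E : Type*) [NormedAddCommGroup E] [NormedSpace ℂ E]
    {M : Type*} [TopologicalSpace M] [ChartedSpace E M] [MulAction (Torus k) M]
    (π : M → NestedProduct k) : Prop where
  /-- the torus action is holomorphic (as `exp : ℂ^k → (ℂˣ)^k` is a local biholomorphism onto) -/
  action_holomorphic :
    ContMDiff (𝓘(ℂ, Fin k → ℂ).prod 𝓘(ℂ, E)) 𝓘(ℂ, E) ω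
      (fun q : (Fin k → ℂ) × M => expTorus q.1 • q.2)
  /-- `π` is holomorphic -/
  holomorphic : ∀ A : Finset (Fin (k + 1)), IsHolomorphicFamily (E := E) (fun x => π x A)
  /-- `π` is equivariant -/
  equivariant : ∀ (t : Torus k) (x : M) (A : Finset (Fin (k + 1))),
    (π (t • x) A).1 = translateIdeal t (π x A).1
  /-- `π` is proper -/
  proper : IsProperMap π
  /-- `π` maps onto the fibre over the flag -/
  range_eq : Set.range π = flagFibre k
  /-- `π` is birational: over a nonempty Zariski open set `W` of configurations, whose preimage is
  dense in `M`, it is an isomorphism with holomorphic inverse `s` -/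
  birational : ∃ (g : MvPolynomial (Fin (k + 1) × Fin k) ℂ) (W : Set (FlaggedConfig k))
    (s : FlaggedConfig k → M),
    W = {p | AffineIndependent ℂ p.1 ∧ MvPolynomial.eval (fun ji => p.1 ji.1 ji.2) g ≠ 0} ∧
    W.Nonempty ∧
    ContMDiffOn 𝓘(ℂ, FlaggedConfig k) 𝓘(ℂ, E) ω s W ∧
    (∀ p ∈ W, IsConfigPoint p.1 (π (s p))) ∧
    (∀ p ∈ W, ∀ x : M, IsConfigPoint p.1 (π x) → x = s p) ∧
    Dense (s '' W)

/-- Isolated fixed points of a torus action. -/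
def IsIsolatedFixedPoint (k : ℕ) {M : Type*} [TopologicalSpace M] [MulAction (Torus k) M]
    (F : M) : Prop :=
  (∀ t : Torus k, t • F = F) ∧
    ∃ U ∈ 𝓝 F, ∀ x ∈ U, (∀ t : Torus k, t • x = x) → x = F

/-- `χ₁, …, χ_n` are the weights, with multiplicity, of the torus on the tangent space at the
fixed point `F`: in some basis, `t` acts as the diagonal matrix with entries `t^{χ_i}`. -/
def IsTangentWeights {k : ℕ} (E : Type*) [NormedAddCommGroup E] [NormedSpace ℂ E]
    {M : Type*} [TopologicalSpace M] [ChartedSpace E M] [MulAction (Torus k) M] (F : M)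
    (χ : Fin (Module.finrank ℂ E) → Fin k → ℤ) : Prop :=
  ∃ b : Module.Basis (Fin (Module.finrank ℂ E)) ℂ E,
    ∀ (t : Torus k) (i : Fin (Module.finrank ℂ E)),
      (mfderiv 𝓘(ℂ, E) 𝓘(ℂ, E) (fun x : M => t • x) F : E →L[ℂ] E) (b i) =
        (∏ j, (t j : ℂ) ^ χ i j) • b i

/-- The equivariant Euler class with weights `χ`, as a function of `z`: the product of the linear
forms `χ_i(z)`. -/
def euler {k n : ℕ} (χ : Fin n → Fin k → ℤ) (z : Fin k → ℂ) : ℂ :=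
  ∏ i, ∑ j, (χ i j : ℂ) * z j

/-! ### Equivariant Chern classes of the approximating tautological bundles -/

open Classical in
/-- The exponents of the monomials outside `I`. For a torus-fixed (i.e. monomial) ideal `I` of
finite colength these monomials are a weight basis of the quotient by `I`. -/
def standardMonomials {k : ℕ} (I : Ideal (CoordRing k)) : Finset (Fin k →₀ ℕ) :=
  if h : {a : Fin k →₀ ℕ | MvPolynomial.monomial a (1 : ℂ) ∉ I}.Finite then h.toFinset else ∅

/-- The equivariant Chern roots at `ξ` of `V^α = ⨁ᵢ V ⊗ 𝒪^{[αᵢ]}`, for `V` with equivariant Chern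
roots `θ`: the sums `θ_ℓ + ∑ᵢ aᵢ zᵢ`, for all blocks `A` of `α`, all `ℓ`, and all weights
`∑ᵢ aᵢ zᵢ` of the fibre at `ξ_A` of the tautological bundle, one for each monomial `x^a` outside
the ideal of `ξ_A`; the monomial `1` contributes `θ_ℓ`. -/
def chernRoots {k r : ℕ} (θ : Fin r → ℂ) (ξ : NestedProduct k)
    (α : Finpartition (Finset.univ : Finset (Fin (k + 1)))) (z : Fin k → ℂ) : Multiset ℂ :=
  α.parts.val.bind fun A =>
    (standardMonomials (ξ A).1).val.bind fun a =>
      (Finset.univ : Finset (Fin r)).val.map fun l => θ l + ∑ i, (a i : ℂ) * z i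

/-- The `d`-th equivariant Chern class of `V^α` at `ξ`. -/
def chernClass {k r : ℕ} (d : ℕ) (θ : Fin r → ℂ) (ξ : NestedProduct k)
    (α : Finpartition (Finset.univ : Finset (Fin (k + 1)))) (z : Fin k → ℂ) : ℂ :=
  (chernRoots θ ξ α z).esymm d

/-! ### Iterated residues at infinity -/

/-- `v` is the iterated residue `Res_{z₁=∞} ⋯ Res_{z_k=∞} f dz`: the integral of
`(2πi)^{-k} f dz` over the tori `|z_i| = R_i` with `1 ≪ R₁ ≪ ⋯ ≪ R_k`, oriented so that
`dz / (z₁ ⋯ z_k)` has residue `(-1)^k`. -/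
def HasIteratedResidue {k : ℕ} (f : (Fin k → ℂ) → ℂ) (v : ℂ) : Prop :=
  ∃ C : ℝ, ∀ R : Fin k → ℝ, (∀ i, 0 < R i) → (∀ i, C ≤ R i) →
    (∀ i j, i < j → C * R i ≤ R j) →
    TorusIntegrable f 0 R ∧
    (-1) ^ k * (1 / (2 * (Real.pi : ℂ) * Complex.I)) ^ k * torusIntegral f 0 R = v

/-- The rational function in the residue contribution of the fixed point over `ξ`, with tangent
weights `χ`. -/
def residueIntegrand {k m r n : ℕ} (d : ℕ) (lam : Fin m → ℂ) (θ : Fin r → ℂ)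
    (ξ : NestedProduct k) (χ : Fin n → Fin k → ℤ)
    (α : Finpartition (Finset.univ : Finset (Fin (k + 1)))) (z : Fin k → ℂ) : ℂ :=
  ((∏ i, ∏ j ∈ Finset.Ioi i, (z i - z j)) * chernClass d θ ξ α z) /
    (euler χ z * ∏ l, ∏ i, (lam i - z l))

end NestedHilbert

end

/-! The residue vanishes for degree reasons. Along a complex ray `t ↦ t z` the Vandermonde factor
has degree k(k-1)/2, the Euler class has degree equal to the dimension of the resolution, and the
factors `lam i - z l` give km. The Chern class has degree at most r(k+1-s), whatever `d` is: in each
of the s blocks the monomial 1 lies outside the ideal, and its r Chern roots `θ l` do not involve z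
(`natDegree_chernRootPolys_esymm_le`). Since the dimension is at least k(k+1)/2 and s ≥ 2, the
inequality r(k-1) ≤ (m-1)k makes the total degree at most -2k, hence at most -(k+1)
(`total_degree_le`).

A function of degree at most -(k+1) along rays integrates to zero over the torus
(`torusIntegral_eq_zero_of_decay`). By invariance the integral may first be averaged over the
diagonal circle `z ↦ t z`; each inner integral is that of `t^(k-1) f(t z) dt`, which is O(t⁻²), so
its contour can be pushed to infinity. No pole is crossed, because enlarging z by `t` keeps it
beyond all `lam i` and only rescales the linear forms of the Euler class.

Two geometric facts remain. The dimension bound (`IsEquivariantResolution.finrank_ge`) holds because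
the inverse of π on generic configurations is an immersion: the points can be read off
holomorphically from their ideals. The weights are nonzero (`tangentWeight_ne_zero`) because
averaging a chart over the compact torus linearizes the action near the fixed point, as in Bochner's
theorem, so a zero weight would produce a curve of fixed points. -/

noncomputable section

namespace NestedHilbert

/-! ### Vanishing of torus integrals of functions decaying at infinity -/

open MeasureTheory Real in
/-- A function holomorphic on `1 ≤ ‖t‖` and of order `t⁻²` at infinity has no residue there. -/
theorem circleIntegral_eq_zero_of_decay {h : ℂ → ℂ} {K : ℝ}
    (hd : ∀ t : ℂ, 1 ≤ ‖t‖ → DifferentiableAt ℂ h t)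
    (hK : ∀ t : ℂ, 1 ≤ ‖t‖ → ‖h t‖ ≤ K / ‖t‖ ^ 2) :
    (∮ t in C(0, 1), h t) = 0 := by
  -- The contour moves to radius ρ, where length times supremum is 2πρ · K/ρ².
  have key : ∀ ρ : ℝ, 1 ≤ ρ → ‖∮ t in C(0, 1), h t‖ ≤ 2 * π * K / ρ := by
    intro ρ hρ
    have hρ0 : 0 < ρ := by linarith
    have heq : (∮ t in C(0, ρ), h t) = ∮ t in C(0, 1), h t := by
      apply Complex.circleIntegral_eq_of_differentiable_on_annulus_off_countable
        one_pos hρ Set.countable_empty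
      · intro t ht
        refine (hd t ?_).continuousAt.continuousWithinAt
        simpa using ht.2
      · intro t ht
        refine hd t ?_
        have : 1 < ‖t‖ := by simpa using ht.1.2
        exact this.le
    rw [← heq]
    refine (circleIntegral.norm_integral_le_of_norm_le_const (C := K / ρ ^ 2) hρ0.le ?_).trans ?_
    · intro t ht
      have ht' : ‖t‖ = ρ := by simpa using ht
      simpa [ht'] using hK t (by rw [ht']; exact hρ)
    · apply le_of_eq
      field_simp
  have hlim : Filter.Tendsto (fun ρ : ℝ => 2 * π * K / ρ) Filter.atTop (𝓝 0) :=
    Filter.Tendsto.div_atTop tendsto_const_nhds Filter.tendsto_id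
  have : ‖∮ t in C(0, 1), h t‖ ≤ 0 :=
    ge_of_tendsto hlim (Filter.eventually_atTop.2 ⟨1, key⟩)
  exact norm_le_zero_iff.1 this

instance fact_zero_lt_two_pi : Fact (0 < 2 * Real.pi) := ⟨Real.two_pi_pos⟩

open MeasureTheory Real in
/-- The previous lemma, as an integral over `ℝ / 2πℤ`. -/
theorem integral_addCircle_eq_zero_of_decay {h : ℂ → ℂ} {K : ℝ}
    (hd : ∀ t : ℂ, 1 ≤ ‖t‖ → DifferentiableAt ℂ h t)
    (hK : ∀ t : ℂ, 1 ≤ ‖t‖ → ‖h t‖ ≤ K / ‖t‖ ^ 2) :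
    ∫ y : AddCircle (2 * π), (AddCircle.toCircle y : ℂ) * h (AddCircle.toCircle y) = 0 := by
  rw [← AddCircle.intervalIntegral_preimage (2 * π) 0]
  have h0 := circleIntegral_eq_zero_of_decay hd hK
  rw [circleIntegral] at h0
  have e : ∀ θ : ℝ, deriv (circleMap 0 1) θ • h (circleMap 0 1 θ) =
      Complex.I * ((AddCircle.toCircle (θ : AddCircle (2 * π)) : ℂ) *
        h (AddCircle.toCircle (θ : AddCircle (2 * π)))) := by
    intro θ
    have : (2 * π / (2 * π) * θ) = θ := by field_simp
    simp only [deriv_circleMap, circleMap_zero, AddCircle.toCircle_apply_mk, this,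
      Circle.coe_exp, smul_eq_mul, Complex.ofReal_one, one_mul]
    ring
  simp only [e, intervalIntegral.integral_const_mul, mul_eq_zero, Complex.I_ne_zero,
    false_or] at h0
  simpa using h0

/-- The torus of radii `R`, parametrized by `(ℝ / 2πℤ)^k`. -/
def angleTorusMap {k : ℕ} (R : Fin k → ℝ) (x : Fin k → AddCircle (2 * Real.pi)) : Fin k → ℂ :=
  fun i => R i * (AddCircle.toCircle (x i) : ℂ)

theorem angleTorusMap_coe {k : ℕ} (R : Fin k → ℝ) (θ : Fin k → ℝ) :
    angleTorusMap R (fun i => (θ i : AddCircle (2 * Real.pi))) = torusMap 0 R θ := by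
  funext i
  simp [angleTorusMap, torusMap, AddCircle.toCircle_apply_mk]

theorem norm_angleTorusMap {k : ℕ} {R : Fin k → ℝ} (hR : ∀ i, 0 < R i)
    (x : Fin k → AddCircle (2 * Real.pi)) (i : Fin k) : ‖angleTorusMap R x i‖ = R i := by
  simp [angleTorusMap, abs_of_pos (hR i), Circle.norm_coe]

theorem continuous_angleTorusMap {k : ℕ} (R : Fin k → ℝ) : Continuous (angleTorusMap R) := by
  refine continuous_pi fun i => continuous_const.mul ?_
  exact continuous_subtype_val.comp (AddCircle.continuous_toCircle.comp (continuous_apply i))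

theorem angleTorusMap_add_const {k : ℕ} (R : Fin k → ℝ) (x : Fin k → AddCircle (2 * Real.pi))
    (y : AddCircle (2 * Real.pi)) :
    angleTorusMap R (x + fun _ => y) = (AddCircle.toCircle y : ℂ) • angleTorusMap R x := by
  funext i
  simp [angleTorusMap, AddCircle.toCircle_add]
  ring

open MeasureTheory Real in
/-- The covering of `(ℝ / 2πℤ)^k` by the box `[0, 2π]^k` preserves the measure. -/
theorem measurePreserving_box (k : ℕ) :
    MeasurePreserving (fun (θ : Fin k → ℝ) (i : Fin k) => (θ i : AddCircle (2 * π)))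
      (volume.restrict (Set.Icc (0 : Fin k → ℝ) fun _ => 2 * π)) volume := by
  have h1 : (volume : Measure (Fin k → ℝ)).restrict (Set.Icc (0 : Fin k → ℝ) fun _ => 2 * π) =
      Measure.pi fun _ => (volume : Measure ℝ).restrict (Set.Ioc 0 (0 + 2 * π)) := by
    rw [← Set.pi_univ_Icc, volume_pi, Measure.restrict_pi_pi]
    congr 1
    funext i
    simp [restrict_Ioc_eq_restrict_Icc]
  rw [h1, volume_pi]
  exact measurePreserving_pi _ _ fun _ => AddCircle.measurePreserving_mk (2 * π) 0

-- The factors come from dz_i = i z_i dθ_i. Working on a compact group makes translation invariance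
-- of the measure available.
open MeasureTheory Real in
theorem torusIntegral_eq_integral_addCircle {k : ℕ} {f : (Fin k → ℂ) → ℂ} {R : Fin k → ℝ}
    (hf : Continuous fun x => f (angleTorusMap R x)) :
    TorusIntegrable f 0 R ∧
    torusIntegral f 0 R = Complex.I ^ k *
      ∫ x : Fin k → AddCircle (2 * π), (∏ i, angleTorusMap R x i) * f (angleTorusMap R x) := by
  have hmp := measurePreserving_box k
  constructor
  · have hint : Integrable (fun x => f (angleTorusMap R x)) volume :=
      hf.integrable_of_hasCompactSupport (HasCompactSupport.of_compactSpace _)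
    have := (hmp.integrable_comp hint.aestronglyMeasurable).2 hint
    simpa only [TorusIntegrable, IntegrableOn, Function.comp_def, angleTorusMap_coe] using this
  · have hc : Continuous fun x => (∏ i, angleTorusMap R x i) * f (angleTorusMap R x) :=
      (continuous_finsetProd _ fun i _ =>
        (continuous_apply i).comp (continuous_angleTorusMap R)).mul hf
    rw [← hmp.map_eq, integral_map hmp.measurable.aemeasurable hc.aestronglyMeasurable]
    simp only [angleTorusMap_coe, torusIntegral, ← integral_const_mul]
    congr 1
    funext θ
    simp [torusMap, Finset.prod_mul_distrib]
    ring

open MeasureTheory Real in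
/-- If `f` is holomorphic and of order `t^{-(k+1)}` along every complex ray `t ↦ t z` from the torus
of radii `R` to infinity, then its integral over that torus vanishes. -/
theorem torusIntegral_eq_zero_of_decay {k : ℕ} (hk : 0 < k) {f : (Fin k → ℂ) → ℂ} {R : Fin k → ℝ}
    (hR : ∀ i, 0 < R i)
    (hc : ∀ z : Fin k → ℂ, (∀ i, ‖z i‖ = R i) → ContinuousAt f z)
    (hd : ∀ z : Fin k → ℂ, (∀ i, ‖z i‖ = R i) → ∀ t : ℂ, 1 ≤ ‖t‖ →
      DifferentiableAt ℂ (fun t : ℂ => f (t • z)) t)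
    (hK : ∀ z : Fin k → ℂ, (∀ i, ‖z i‖ = R i) → ∃ K : ℝ, ∀ t : ℂ, 1 ≤ ‖t‖ →
      ‖f (t • z)‖ ≤ K / ‖t‖ ^ (k + 1)) :
    TorusIntegrable f 0 R ∧ torusIntegral f 0 R = 0 := by
  have hf : Continuous fun x => f (angleTorusMap R x) :=
    continuous_iff_continuousAt.2 fun x =>
      ContinuousAt.comp (f := angleTorusMap R) (hc _ (norm_angleTorusMap hR x))
        (continuous_angleTorusMap R).continuousAt
  obtain ⟨hi, he⟩ := torusIntegral_eq_integral_addCircle hf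
  refine ⟨hi, ?_⟩
  set G : (Fin k → AddCircle (2 * π)) → ℂ :=
    fun x => (∏ i, angleTorusMap R x i) * f (angleTorusMap R x) with hG
  have hGc : Continuous G :=
    (continuous_finsetProd _ fun i _ =>
      (continuous_apply i).comp (continuous_angleTorusMap R)).mul hf
  -- This is the integral over one orbit of the diagonal circle. The product of the coordinates
  -- contributes t^k; one factor t is the Jacobian of dt and t^(k-1) stays in the integrand, which
  -- is then O(t⁻²).
  have hline : ∀ x, ∫ y : AddCircle (2 * π), G (x + fun _ => y) = 0 := by
    intro x
    obtain ⟨K, hK⟩ := hK _ (norm_angleTorusMap hR x)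
    have h0 := integral_addCircle_eq_zero_of_decay
      (h := fun t => t ^ (k - 1) * ((∏ i, angleTorusMap R x i) * f (t • angleTorusMap R x)))
      (K := ‖∏ i, angleTorusMap R x i‖ * K)
      (fun t ht => (differentiableAt_id.pow _).mul
        ((hd _ (norm_angleTorusMap hR x) t ht).const_mul _))
      (fun t ht => ?_)
    · rw [← h0]
      congr 1
      funext y
      simp only [hG, angleTorusMap_add_const, Pi.smul_apply, smul_eq_mul, Finset.prod_mul_distrib,
        Finset.prod_const, Finset.card_univ, Fintype.card_fin]
      obtain ⟨j, rfl⟩ : ∃ j, k = j + 1 := ⟨k - 1, by omega⟩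
      simp only [Nat.add_sub_cancel]
      ring
    · obtain ⟨j, rfl⟩ : ∃ j, k = j + 1 := ⟨k - 1, by omega⟩
      have ht0 : 0 < ‖t‖ := by linarith
      simp only [Nat.add_sub_cancel, norm_mul, norm_pow]
      calc ‖t‖ ^ j * (‖∏ i, angleTorusMap R x i‖ * ‖f (t • angleTorusMap R x)‖)
          ≤ ‖t‖ ^ j * (‖∏ i, angleTorusMap R x i‖ * (K / ‖t‖ ^ (j + 1 + 1))) := by
            gcongr; exact hK t ht
        _ = _ := by field_simp; ring
  have hshift : ∀ y : AddCircle (2 * π), ∫ x, G (x + fun _ => y) = ∫ x, G x := fun y =>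
    integral_add_right_eq_self G (fun _ : Fin k => y)
  -- By Fubini the double integral is zero; by invariance it is also the total mass 2π of the circle
  -- times the integral of `G`.
  have hswap : ∫ y : AddCircle (2 * π), ∫ x, G (x + fun _ => y) = 0 := by
    rw [integral_integral_swap]
    · simp [hline]
    · refine Continuous.integrable_of_hasCompactSupport ?_ (HasCompactSupport.of_compactSpace _)
      exact hGc.comp (continuous_snd.add (continuous_pi fun _ => continuous_fst))
  simp only [hshift, integral_const, smul_eq_zero] at hswap
  have hG0 : ∫ x, G x = 0 := by
    refine hswap.resolve_left ?_
    simp [Measure.real, Real.pi_pos.le, Real.pi_ne_zero]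
  rw [he, hG0, mul_zero]

/-! ### Elementary symmetric polynomials of families of polynomials -/

-- Each term is a product over a sub-multiset, so the bound is uniform in `d`.
open Polynomial in
theorem natDegree_multiset_esymm_le (S : Multiset ℂ[X]) (d : ℕ) :
    (S.esymm d).natDegree ≤ (S.map natDegree).sum := by
  rw [Multiset.esymm]
  refine (natDegree_multiset_sum_le _).trans ?_
  refine Multiset.max_le_of_forall_le _ _ ?_
  simp only [Multiset.map_map, Function.comp_apply, Multiset.mem_map]
  rintro n ⟨T, hT, rfl⟩
  refine (natDegree_multiset_prod_le T).trans ?_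
  obtain ⟨U, rfl⟩ := Multiset.le_iff_exists_add.1 (Multiset.mem_powersetCard.1 hT).1
  simp

theorem map_multiset_esymm {R S : Type*} [CommSemiring R] [CommSemiring S] (φ : R →+* S)
    (s : Multiset R) (d : ℕ) : φ (s.esymm d) = (s.map φ).esymm d := by
  simp only [Multiset.esymm, map_multiset_sum, Multiset.powersetCard_map, Multiset.map_map,
    Function.comp_def, map_multiset_prod]

open Polynomial in
theorem exists_norm_eval_le (p : ℂ[X]) {N : ℕ} (hp : p.natDegree ≤ N) :
    ∃ K : ℝ, ∀ t : ℂ, 1 ≤ ‖t‖ → ‖p.eval t‖ ≤ K * ‖t‖ ^ N := by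
  refine ⟨∑ i ∈ Finset.range (N + 1), ‖p.coeff i‖, fun t ht => ?_⟩
  rw [eval_eq_sum_range' (Nat.lt_succ_of_le hp), Finset.sum_mul]
  refine (norm_sum_le _ _).trans (Finset.sum_le_sum fun i hi => ?_)
  rw [norm_mul, norm_pow]
  gcongr
  exact Nat.lt_succ_iff.1 (Finset.mem_range.1 hi)

/-! ### Standard monomials of torus-fixed ideals -/

/-- The character `t ↦ t^a` of the torus. -/
def torusChar {k : ℕ} (a : Fin k →₀ ℕ) : Torus k →* ℂ where
  toFun t := ∏ i, (t i : ℂ) ^ a i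
  map_one' := by simp
  map_mul' s t := by simp [mul_pow, Finset.prod_mul_distrib]

theorem torusChar_injective {k : ℕ} : Function.Injective (torusChar (k := k)) := by
  intro a b hab
  ext i
  have h := DFunLike.congr_fun hab (Pi.mulSingle i (Units.mk0 (2 : ℂ) two_ne_zero))
  have e : ∀ c : Fin k →₀ ℕ,
      torusChar c (Pi.mulSingle i (Units.mk0 (2 : ℂ) two_ne_zero)) = (2 : ℂ) ^ c i := by
    intro c
    simp only [torusChar, MonoidHom.coe_mk, OneHom.coe_mk]
    rw [Finset.prod_eq_single i]
    · simp
    · intro j _ hj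
      simp [Pi.mulSingle_eq_of_ne hj]
    · simp
  rw [e, e] at h
  exact Nat.pow_right_injective le_rfl (by exact_mod_cast h)

theorem scale_monomial {k : ℕ} (t : Torus k) (a : Fin k →₀ ℕ) :
    scale t (MvPolynomial.monomial a 1) = torusChar a t • MvPolynomial.monomial a (1 : ℂ) := by
  rw [scale, MvPolynomial.aeval_monomial, MvPolynomial.monomial_eq, Finsupp.prod_fintype _ _ (by simp),
    Finsupp.prod_fintype _ _ (by simp), MvPolynomial.smul_eq_C_mul]
  simp [torusChar, mul_pow, Finset.prod_mul_distrib]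

/-- The monomials outside a torus-fixed ideal are linearly independent modulo the ideal. -/
theorem linearIndependent_monClass {k : ℕ} {I : Ideal (CoordRing k)}
    (hI : ∀ t : Torus k, translateIdeal t I = I) :
    LinearIndependent ℂ
      (fun a : {a : Fin k →₀ ℕ | MvPolynomial.monomial a (1 : ℂ) ∉ I} => monClass I a) := by
  have hmk : ∀ (a : Fin k →₀ ℕ) (c : ℂ),
      Ideal.Quotient.mk I (c • MvPolynomial.monomial a (1 : ℂ)) = c • monClass I a := fun a c => rfl
  rw [linearIndependent_iff']
  intro s c hc a ha
  have hmem : ∑ b ∈ s, c b • MvPolynomial.monomial (b : Fin k →₀ ℕ) (1 : ℂ) ∈ I := by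
    rw [← Ideal.Quotient.eq_zero_iff_mem, map_sum]
    simpa only [hmk] using hc
  -- Moving the relation by `t` keeps it in the ideal and multiplies each coefficient by a
  -- character.
  have ht : ∀ t : Torus k, ∑ b ∈ s, (c b * torusChar (b : Fin k →₀ ℕ) t) • monClass I b = 0 := by
    intro t
    have hmem' := (hI t).ge hmem
    rw [translateIdeal, Ideal.mem_comap, map_sum, ← Ideal.Quotient.eq_zero_iff_mem,
      map_sum] at hmem'
    simpa only [map_smul, scale_monomial, smul_smul, hmk] using hmem'
  have hφ : c a • monClass I (a : Fin k →₀ ℕ) = 0 := by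
    rw [← Module.forall_dual_apply_eq_zero_iff ℂ]
    intro φ
    -- After applying a functional `φ`, this is a relation between distinct characters, so
    -- Dedekind's independence theorem kills every term.
    have hli : LinearIndependent ℂ (fun b : {a : Fin k →₀ ℕ | MvPolynomial.monomial a (1 : ℂ) ∉ I} =>
        (torusChar (b : Fin k →₀ ℕ) : Torus k → ℂ)) :=
      (linearIndependent_monoidHom (Torus k) ℂ).comp _
        (torusChar_injective.comp Subtype.val_injective)
    refine (linearIndependent_iff'.1 hli) s (fun b => φ (c b • monClass I (b : Fin k →₀ ℕ))) ?_ a ha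
    funext t
    have := congrArg φ (ht t)
    rw [map_sum, map_zero] at this
    rw [Finset.sum_apply, Pi.zero_apply, ← this]
    refine Finset.sum_congr rfl fun b _ => ?_
    simp only [Pi.smul_apply, smul_eq_mul, map_smul]
    ring
  refine (smul_eq_zero.1 hφ).resolve_right fun h => a.2 ?_
  exact Ideal.Quotient.eq_zero_iff_mem.1 h

/-- The degree estimate needs only this inequality, so independence suffices. Independence also
gives finiteness, so `standardMonomials` does not take its default value `∅`. -/
theorem card_standardMonomials_le {k n : ℕ} (I : HilbPt k n)
    (hI : ∀ t : Torus k, translateIdeal t I.1 = I.1) : (standardMonomials I.1).card ≤ n := by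
  have hli := linearIndependent_monClass hI
  have := I.2.1
  have hfin : {a : Fin k →₀ ℕ | MvPolynomial.monomial a (1 : ℂ) ∉ I.1}.Finite :=
    Set.finite_coe_iff.1 hli.finite
  have := hfin.fintype
  rw [standardMonomials, dif_pos hfin, ← Set.ncard_eq_toFinset_card _ hfin,
    ← Nat.card_coe_set_eq, Nat.card_eq_fintype_card]
  exact hli.fintype_card_le_finrank.trans_eq I.2.2

/-- Positive colength makes the ideal proper. This membership is the source of the saving of r in
degree per block. -/
theorem zero_mem_standardMonomials {k n : ℕ} (hn : 0 < n) (I : HilbPt k n)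
    (hI : ∀ t : Torus k, translateIdeal t I.1 = I.1) : 0 ∈ standardMonomials I.1 := by
  have := I.2.1
  have hfin : {a : Fin k →₀ ℕ | MvPolynomial.monomial a (1 : ℂ) ∉ I.1}.Finite :=
    Set.finite_coe_iff.1 (linearIndependent_monClass hI).finite
  rw [standardMonomials, dif_pos hfin, Set.Finite.mem_toFinset, Set.mem_ofPred_eq]
  intro h
  have htop : I.1 = ⊤ := (Ideal.eq_top_iff_one _).2 (by simpa using h)
  have h0 := I.2.2
  have : Subsingleton (CoordRing k ⧸ I.1) := Ideal.Quotient.subsingleton_iff.2 htop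
  rw [Module.finrank_zero_of_subsingleton] at h0
  omega

/-! ### Chern classes along rays -/

/-- The Chern roots at `t z`, as polynomials in `t`. -/
def chernRootPolys {k r : ℕ} (θ : Fin r → ℂ) (ξ : NestedProduct k)
    (α : Finpartition (Finset.univ : Finset (Fin (k + 1)))) (z : Fin k → ℂ) :
    Multiset (Polynomial ℂ) :=
  α.parts.val.bind fun A =>
    (standardMonomials (ξ A).1).val.bind fun a =>
      (Finset.univ : Finset (Fin r)).val.map fun l =>
        Polynomial.C (θ l) + Polynomial.C (∑ i, (a i : ℂ) * z i) * Polynomial.X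

theorem chernClass_smul {k r : ℕ} (d : ℕ) (θ : Fin r → ℂ) (ξ : NestedProduct k)
    (α : Finpartition (Finset.univ : Finset (Fin (k + 1)))) (z : Fin k → ℂ) (t : ℂ) :
    chernClass d θ ξ α (t • z) = ((chernRootPolys θ ξ α z).esymm d).eval t := by
  rw [← Polynomial.coe_evalRingHom, map_multiset_esymm, chernClass]
  congr 1
  simp only [chernRoots, chernRootPolys, Multiset.map_bind, Multiset.map_map, Function.comp_def,
    Polynomial.coe_evalRingHom, Polynomial.eval_add, Polynomial.eval_mul, Polynomial.eval_C,
    Polynomial.eval_X, Pi.smul_apply, smul_eq_mul, Finset.sum_mul]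
  simp only [mul_assoc, mul_comm t]

/-- Since every block contributes a trivial summand to `V^α`, the Chern classes of `V^α` at a torus
fixed point have degree at most `r (k + 1 - s)` in `z`. -/
theorem natDegree_chernRootPolys_esymm_le {k r : ℕ} (d : ℕ) (θ : Fin r → ℂ) (ξ : NestedProduct k)
    (hξ : ∀ (t : Torus k) (A : Finset (Fin (k + 1))), translateIdeal t (ξ A).1 = (ξ A).1)
    (α : Finpartition (Finset.univ : Finset (Fin (k + 1)))) (z : Fin k → ℂ) :
    ((chernRootPolys θ ξ α z).esymm d).natDegree ≤ r * (k + 1 - α.parts.card) := by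
  refine (natDegree_multiset_esymm_le _ _).trans ?_
  have hroot : ∀ (a : Fin k →₀ ℕ) (l : Fin r),
      (Polynomial.C (θ l) + Polynomial.C (∑ i, (a i : ℂ) * z i) * Polynomial.X).natDegree ≤
        if a = 0 then 0 else 1 := by
    intro a l
    split_ifs with h
    · simp [h]
    · refine (Polynomial.natDegree_add_le _ _).trans (max_le (by simp) ?_)
      exact (Polynomial.natDegree_C_mul_le _ _).trans Polynomial.natDegree_X_le
  -- The extra 1 is the trivial monomial; summing over the blocks turns it into the number of parts.
  have hblock : ∀ A ∈ α.parts, ∑ a ∈ standardMonomials (ξ A).1, (if a = 0 then 0 else 1) + 1 ≤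
      A.card := by
    intro A hA
    have h0 := zero_mem_standardMonomials
      (Finset.card_pos.2 (α.nonempty_of_mem_parts hA)) (ξ A) (fun t => hξ t A)
    have hle := card_standardMonomials_le (ξ A) (fun t => hξ t A)
    rw [← Finset.sum_erase_add _ _ h0, if_pos rfl,
      Finset.sum_congr rfl (fun a ha => if_neg (Finset.ne_of_mem_erase ha)), Finset.sum_const,
      Finset.card_erase_of_mem h0]
    have := Finset.card_pos.2 ⟨_, h0⟩
    simp only [smul_eq_mul, mul_one, add_zero]
    omega
  have hsum : ∑ A ∈ α.parts, ∑ a ∈ standardMonomials (ξ A).1, (if a = 0 then 0 else 1) ≤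
      k + 1 - α.parts.card := by
    have h := Finset.sum_le_sum hblock
    rw [Finset.sum_add_distrib, α.sum_card_parts, Finset.card_univ, Fintype.card_fin] at h
    simp only [Finset.sum_const, smul_eq_mul, mul_one] at h
    omega
  calc ((chernRootPolys θ ξ α z).map Polynomial.natDegree).sum
      = ∑ A ∈ α.parts, ∑ a ∈ standardMonomials (ξ A).1, ∑ l : Fin r,
          (Polynomial.C (θ l) + Polynomial.C (∑ i, (a i : ℂ) * z i) * Polynomial.X).natDegree := by
        simp only [chernRootPolys, Multiset.map_bind, Multiset.sum_bind, Multiset.map_map]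
        rfl
    _ ≤ ∑ A ∈ α.parts, ∑ a ∈ standardMonomials (ξ A).1, ∑ l : Fin r, if a = 0 then 0 else 1 :=
        by exact Finset.sum_le_sum fun A _ => Finset.sum_le_sum fun a _ =>
          Finset.sum_le_sum fun l _ => hroot a l
    _ = r * ∑ A ∈ α.parts, ∑ a ∈ standardMonomials (ξ A).1, (if a = 0 then 0 else 1) := by
        simp only [Finset.sum_const, Finset.card_univ, Fintype.card_fin, smul_eq_mul,
          Finset.mul_sum]
    _ ≤ r * (k + 1 - α.parts.card) := Nat.mul_le_mul_left _ hsum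

theorem continuous_chernClass {k r : ℕ} (d : ℕ) (θ : Fin r → ℂ) (ξ : NestedProduct k)
    (α : Finpartition (Finset.univ : Finset (Fin (k + 1)))) :
    Continuous (chernClass d θ ξ α) := by
  -- The index multiset does not depend on `z`, so the class is a fixed finite sum of products of
  -- affine functions.
  let S : Multiset ((Fin k →₀ ℕ) × Fin r) := α.parts.val.bind fun A =>
    (standardMonomials (ξ A).1).val.bind fun a =>
      (Finset.univ : Finset (Fin r)).val.map fun l => (a, l)
  have hS : ∀ z : Fin k → ℂ, chernClass d θ ξ α z =
      ((S.powersetCard d).map fun T =>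
        (T.map fun p => θ p.2 + ∑ i, (p.1 i : ℂ) * z i).prod).sum := by
    intro z
    have : chernRoots θ ξ α z = S.map fun p => θ p.2 + ∑ i, (p.1 i : ℂ) * z i := by
      simp only [chernRoots, S, Multiset.map_bind, Multiset.map_map, Function.comp_def]
    rw [chernClass, this, Multiset.esymm, Multiset.powersetCard_map, Multiset.map_map]
    rfl
  simp only [funext hS]
  refine continuous_multiset_sum _ fun T _ => continuous_multiset_prod _ fun p _ => ?_
  fun_prop

/-! ### The residue integrand on tori of rapidly increasing radii -/

/-- A nonzero integral linear form does not vanish on tori of rapidly increasing radii. -/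
theorem linearForm_ne_zero {k : ℕ} {χ : Fin k → ℤ} (hχ : χ ≠ 0) {C : ℝ}
    (hC : 1 + ∑ j, |(χ j : ℝ)| ≤ C) {z : Fin k → ℂ} (hz : ∀ i, 0 < ‖z i‖)
    (hlt : ∀ i j, i < j → C * ‖z i‖ ≤ ‖z j‖) : ∑ j, (χ j : ℂ) * z j ≠ 0 := by
  have hne : (Finset.univ.filter fun j => χ j ≠ 0).Nonempty := by
    obtain ⟨j, hj⟩ := Function.ne_iff.1 hχ
    exact ⟨j, by simpa using hj⟩
  -- The term of largest index with nonzero coefficient dominates: all other nonzero terms together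
  -- are at most (∑|χ|)/C < 1 times `‖z j‖`.
  obtain ⟨j, hj, hmax⟩ := Finset.exists_max_image _ id hne
  have hχj : χ j ≠ 0 := by simpa using hj
  intro h0
  have hC0 : 0 < C := by
    have : 0 ≤ ∑ j, |(χ j : ℝ)| := Finset.sum_nonneg fun _ _ => abs_nonneg _
    linarith
  rw [← Finset.add_sum_erase _ _ (Finset.mem_univ j)] at h0
  have h1 : ‖z j‖ ≤ ‖(χ j : ℂ) * z j‖ := by
    rw [norm_mul, Complex.norm_intCast]
    have : (1 : ℝ) ≤ |(χ j : ℝ)| := by exact_mod_cast Int.one_le_abs hχj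
    exact le_mul_of_one_le_left (norm_nonneg _) this
  rw [eq_neg_of_add_eq_zero_left h0, norm_neg] at h1
  have h2 : C * ‖z j‖ ≤ (∑ l, |(χ l : ℝ)|) * ‖z j‖ := by
    calc C * ‖z j‖ ≤ C * ∑ l ∈ Finset.univ.erase j, ‖(χ l : ℂ) * z l‖ := by
          gcongr; exact h1.trans (norm_sum_le _ _)
      _ = ∑ l ∈ Finset.univ.erase j, |(χ l : ℝ)| * (C * ‖z l‖) := by
          rw [Finset.mul_sum]
          refine Finset.sum_congr rfl fun l _ => ?_
          rw [norm_mul, Complex.norm_intCast]; ring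
      _ ≤ ∑ l ∈ Finset.univ.erase j, |(χ l : ℝ)| * ‖z j‖ := by
          refine Finset.sum_le_sum fun l hl => ?_
          by_cases hl0 : χ l = 0
          · simp [hl0]
          · have hle : l ≤ j := hmax l (by simpa using hl0)
            exact mul_le_mul_of_nonneg_left
              (hlt l j (lt_of_le_of_ne hle (Finset.ne_of_mem_erase hl))) (abs_nonneg _)
      _ ≤ _ := by
          rw [← Finset.sum_mul]
          refine mul_le_mul_of_nonneg_right ?_ (norm_nonneg _)
          exact Finset.sum_le_sum_of_subset_of_nonneg (Finset.subset_univ _)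
            fun _ _ _ => abs_nonneg _
  have h3 := le_of_mul_le_mul_right h2 (hz j)
  linarith

theorem euler_smul {k n : ℕ} (χ : Fin n → Fin k → ℤ) (t : ℂ) (z : Fin k → ℂ) :
    euler χ (t • z) = t ^ n * euler χ z := by
  have : ∀ i, ∑ j, (χ i j : ℂ) * (t • z) j = t * ∑ j, (χ i j : ℂ) * z j := by
    intro i
    rw [Finset.mul_sum]
    refine Finset.sum_congr rfl fun j _ => ?_
    simp only [Pi.smul_apply, smul_eq_mul]
    ring
  simp only [euler, this, Finset.prod_mul_distrib, Finset.prod_const, Finset.card_univ,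
    Fintype.card_fin]

theorem vandermonde_smul {k : ℕ} (t : ℂ) (z : Fin k → ℂ) :
    ∏ i, ∏ j ∈ Finset.Ioi i, ((t • z) i - (t • z) j) =
      t ^ (k * (k - 1) / 2) * ∏ i, ∏ j ∈ Finset.Ioi i, (z i - z j) := by
  have hcard : ∑ i : Fin k, (Finset.Ioi i).card = k * (k - 1) / 2 := by
    simp only [Fin.card_Ioi]
    rw [Fin.sum_univ_eq_sum_range (fun i => k - 1 - i), Finset.sum_range_reflect (fun i => i),
      Finset.sum_range_id]
  simp only [Pi.smul_apply, smul_eq_mul, ← mul_sub, Finset.prod_mul_distrib, Finset.prod_const,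
    Finset.prod_pow_eq_pow_sum, hcard]

theorem le_norm_prod_sub_smul {k m : ℕ} (lam : Fin m → ℂ) {z : Fin k → ℂ}
    (hz : ∀ l i, ‖lam i‖ + 1 ≤ ‖z l‖) {t : ℂ} (ht : 1 ≤ ‖t‖) :
    ‖t‖ ^ (k * m) ≤ ‖∏ l, ∏ i, (lam i - (t • z) l)‖ := by
  have h1 : ∀ l i, ‖t‖ ≤ ‖lam i - (t • z) l‖ := by
    intro l i
    have h2 : ‖t • z l‖ - ‖lam i‖ ≤ ‖lam i - t • z l‖ := by
      rw [norm_sub_rev]; exact norm_sub_norm_le _ _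
    rw [norm_smul] at h2
    have h3 := hz l i
    have h4 := norm_nonneg (lam i)
    rw [Pi.smul_apply]
    -- The estimate is ‖t‖‖z l‖ - ‖lam i‖ ≥ ‖t‖(‖lam i‖ + 1) - ‖lam i‖ ≥ ‖t‖.
    nlinarith
  calc ‖t‖ ^ (k * m) = ∏ _l : Fin k, ∏ _i : Fin m, ‖t‖ := by
        simp only [Finset.prod_const, Finset.card_univ, Fintype.card_fin, ← pow_mul, mul_comm]
    _ ≤ _ := by
        simp only [norm_prod]
        exact Finset.prod_le_prod (fun _ _ => Finset.prod_nonneg fun _ _ => norm_nonneg _)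
          fun l _ => Finset.prod_le_prod (fun _ _ => norm_nonneg _) fun i _ => h1 l i

theorem differentiable_comp_smul {k : ℕ} {g : (Fin k → ℂ) → ℂ} (hg : Differentiable ℂ g)
    (z : Fin k → ℂ) : Differentiable ℂ fun t : ℂ => g (t • z) :=
  hg.comp (differentiable_id.smul_const z)

/-- The iterated residue at infinity of the residue integrand vanishes if the integrand has total
degree less than `-k` and its denominator is a product of nonzero factors. -/
theorem hasIteratedResidue_residueIntegrand_zero {k m r n : ℕ} (hk : 0 < k) (d : ℕ)
    (lam : Fin m → ℂ) (θ : Fin r → ℂ) (ξ : NestedProduct k) (χ : Fin n → Fin k → ℤ)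
    (α : Finpartition (Finset.univ : Finset (Fin (k + 1))))
    (hξ : ∀ (t : Torus k) (A : Finset (Fin (k + 1))), translateIdeal t (ξ A).1 = (ξ A).1)
    (hχ : ∀ i, χ i ≠ 0)
    (hdeg : k * (k - 1) / 2 + r * (k + 1 - α.parts.card) + (k + 1) ≤ n + k * m) :
    HasIteratedResidue (residueIntegrand d lam θ ξ χ α) 0 := by
  -- One constant serves both purposes: as a lower bound for the radii it clears the `lam i`, and as
  -- a ratio of successive radii it exceeds the coefficient sum of every weight.
  refine ⟨1 + ∑ i, ‖lam i‖ + ∑ i, ∑ j, |(χ i j : ℝ)|, fun R hR0 hRC hRR => ?_⟩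
  set C := 1 + ∑ i, ‖lam i‖ + ∑ i, ∑ j, |(χ i j : ℝ)| with hC
  have hΛ : ∀ i, ‖lam i‖ ≤ ∑ i, ‖lam i‖ := fun i =>
    Finset.single_le_sum (f := fun i => ‖lam i‖) (fun _ _ => norm_nonneg _) (Finset.mem_univ i)
  have hX : ∀ i, ∑ j, |(χ i j : ℝ)| ≤ ∑ i, ∑ j, |(χ i j : ℝ)| := fun i =>
    Finset.single_le_sum (f := fun i => ∑ j, |(χ i j : ℝ)|)
      (fun _ _ => Finset.sum_nonneg fun _ _ => abs_nonneg _) (Finset.mem_univ i)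
  have hΛ0 : 0 ≤ ∑ i, ‖lam i‖ := Finset.sum_nonneg fun _ _ => norm_nonneg _
  have hX0 : 0 ≤ ∑ i, ∑ j, |(χ i j : ℝ)| :=
    Finset.sum_nonneg fun _ _ => Finset.sum_nonneg fun _ _ => abs_nonneg _
  have heuler : ∀ z : Fin k → ℂ, (∀ i, ‖z i‖ = R i) → euler χ z ≠ 0 := by
    intro z hz
    refine Finset.prod_ne_zero_iff.2 fun i _ => linearForm_ne_zero (C := C) (hχ i) ?_ ?_ ?_
    · linarith [hX i]
    · intro j; rw [hz]; exact hR0 j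
    · intro i j hij; rw [hz, hz]; exact hRR i j hij
  have hlam : ∀ z : Fin k → ℂ, (∀ i, ‖z i‖ = R i) → ∀ l i, ‖lam i‖ + 1 ≤ ‖z l‖ := by
    intro z hz l i
    rw [hz]
    linarith [hΛ i, hRC l]
  have hden : ∀ z : Fin k → ℂ, (∀ i, ‖z i‖ = R i) → ∀ t : ℂ, 1 ≤ ‖t‖ →
      euler χ (t • z) * ∏ l, ∏ i, (lam i - (t • z) l) ≠ 0 := by
    intro z hz t ht
    have ht0 : t ≠ 0 := norm_pos_iff.1 (by linarith)
    refine mul_ne_zero ?_ ?_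
    · rw [euler_smul]
      exact mul_ne_zero (pow_ne_zero _ ht0) (heuler z hz)
    · refine norm_pos_iff.1 (lt_of_lt_of_le ?_ (le_norm_prod_sub_smul lam (hlam z hz) ht))
      positivity
  have hvan : Differentiable ℂ fun z : Fin k → ℂ => ∏ i, ∏ j ∈ Finset.Ioi i, (z i - z j) := by
    fun_prop
  have hdeneul : Differentiable ℂ
      fun z : Fin k → ℂ => euler χ z * ∏ l, ∏ i, (lam i - z l) := by
    unfold euler
    fun_prop
  suffices h : TorusIntegrable (residueIntegrand d lam θ ξ χ α) 0 R ∧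
      torusIntegral (residueIntegrand d lam θ ξ χ α) 0 R = 0 from
    ⟨h.1, by rw [h.2, mul_zero]⟩
  refine torusIntegral_eq_zero_of_decay hk hR0 ?_ ?_ ?_
  · intro z hz
    refine ContinuousAt.div ?_ hdeneul.continuous.continuousAt ?_
    · exact (hvan.continuous.mul (continuous_chernClass d θ ξ α)).continuousAt
    · simpa using hden z hz 1 (by simp)
  · intro z hz t ht
    refine DifferentiableAt.div ?_ (differentiable_comp_smul hdeneul z t) (hden z hz t ht)
    refine (differentiable_comp_smul hvan z t).mul ?_
    simp only [chernClass_smul]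
    exact Polynomial.differentiableAt _
  · intro z hz
    -- `K` may depend on `z`, since decay is only required on each ray separately.
    obtain ⟨K, hK⟩ := exists_norm_eval_le _ (natDegree_chernRootPolys_esymm_le d θ ξ hξ α z)
    have hK0 : 0 ≤ K := by
      have := (norm_nonneg _).trans (hK 1 (by simp))
      simpa using this
    set Δ := ∏ i, ∏ j ∈ Finset.Ioi i, (z i - z j) with hΔ
    set D := r * (k + 1 - α.parts.card) with hD
    refine ⟨‖Δ‖ * K / ‖euler χ z‖, fun t ht => ?_⟩
    have ht0 : 0 < ‖t‖ := by linarith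
    have he0 : 0 < ‖euler χ z‖ := norm_pos_iff.2 (heuler z hz)
    rw [residueIntegrand, vandermonde_smul, euler_smul, chernClass_smul, norm_div, norm_mul,
      norm_mul, norm_mul, norm_mul, norm_pow, norm_pow]
    calc _ ≤ ‖t‖ ^ (k * (k - 1) / 2) * ‖Δ‖ * (K * ‖t‖ ^ D) /
          (‖t‖ ^ n * ‖euler χ z‖ * ‖t‖ ^ (k * m)) := by
          gcongr
          · exact hK t ht
          · exact le_norm_prod_sub_smul lam (hlam z hz) ht
      _ = ‖Δ‖ * K / ‖euler χ z‖ * (‖t‖ ^ (k * (k - 1) / 2 + D) / ‖t‖ ^ (n + k * m)) := by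
          rw [pow_add, pow_add]
          field_simp
      _ ≤ ‖Δ‖ * K / ‖euler χ z‖ * (1 / ‖t‖ ^ (k + 1)) := by
          gcongr ?_ * ?_
          rw [div_le_div_iff₀ (by positivity) (by positivity), one_mul, ← pow_add]
          exact pow_le_pow_right₀ ht hdeg
      _ = _ := by ring

/-! ### The dimension of a resolution of the fibre over the flag -/

/-- With p₀ = 0, the point p_j has j free coordinates, for a total of 0 + 1 + ⋯ + k; subtracting the
mean then balances the configuration without changing differences. -/
theorem finrank_flaggedConfig_ge (k : ℕ) :
    k * (k + 1) / 2 ≤ Module.finrank ℂ (FlaggedConfig k) := by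
  let ext : (((j : Fin (k + 1)) × Fin j) → ℂ) →ₗ[ℂ] (Fin (k + 1) → Fin k → ℂ) :=
    { toFun := fun u j i => if h : (i : ℕ) < j then u ⟨j, ⟨i, h⟩⟩ else 0
      map_add' := fun u v => by
        funext j i
        by_cases h : (i : ℕ) < j <;> simp [h]
      map_smul' := fun c u => by
        funext j i
        by_cases h : (i : ℕ) < j <;> simp [h] }
  let mean : (Fin (k + 1) → Fin k → ℂ) →ₗ[ℂ] (Fin k → ℂ) :=
    ((k + 1 : ℂ)⁻¹) • ∑ j, LinearMap.proj j
  have hk : (k + 1 : ℂ) ≠ 0 := by exact_mod_cast Nat.succ_ne_zero k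
  let centre : (((j : Fin (k + 1)) × Fin j) → ℂ) →ₗ[ℂ] (Fin (k + 1) → Fin k → ℂ) :=
    LinearMap.pi fun j => LinearMap.proj j ∘ₗ ext - mean ∘ₗ ext
  have hcentre : ∀ u j, centre u j = ext u j - mean (ext u) := fun u j => rfl
  have hmem : ∀ u, centre u ∈ FlaggedConfig k := by
    intro u
    constructor
    · simp only [hcentre, Finset.sum_sub_distrib, Finset.sum_const, Finset.card_univ,
        Fintype.card_fin]
      simp only [mean, LinearMap.smul_apply, LinearMap.sum_apply, LinearMap.proj_apply]
      rw [← Nat.cast_smul_eq_nsmul ℂ, smul_smul, Nat.cast_succ, mul_inv_cancel₀ hk, one_smul,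
        sub_self]
    · intro j i hji
      have : ¬ (i : ℕ) < j := by omega
      simp [hcentre, ext, this]
  have hinj : Function.Injective (centre.codRestrict (FlaggedConfig k) hmem) := by
    rw [LinearMap.injective_codRestrict_iff, injective_iff_map_eq_zero]
    rintro u hu
    funext ⟨j, i⟩
    -- The parameters are recovered from p_j - p₀, where the mean cancels.
    have hi : (i : ℕ) < k := by omega
    have h1 := congrFun (congrFun hu j) ⟨i, hi⟩
    have h2 := congrFun (congrFun hu 0) ⟨i, hi⟩
    simp only [hcentre, Pi.sub_apply, Pi.zero_apply] at h1 h2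
    have h3 : ext u 0 ⟨i, hi⟩ = 0 := by simp [ext]
    have h4 : ext u j ⟨i, hi⟩ = u ⟨j, i⟩ := by simp [ext]
    rw [h4] at h1
    rw [h3] at h2
    simpa using h1.trans h2.symm
  have h := LinearMap.finrank_le_finrank_of_injective hinj
  rw [Module.finrank_fintype_fun_eq_card, Fintype.card_sigma] at h
  refine le_trans (le_of_eq ?_) h
  simp only [Fintype.card_fin]
  rw [Fin.sum_univ_eq_sum_range (fun i => i), Finset.sum_range_id]
  simp [mul_comm]

/-- On the chart of `B ∋ b`, the coordinates of a single point are the coefficients of `x^b` in the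
expansions of the monomials `x_i x^b`. -/
theorem hilbCoord_vanishingIdeal_singleton {k : ℕ} {B : Finset (Fin k →₀ ℕ)} (b : B)
    (x : Fin k → ℂ) (hI : MvPolynomial.vanishingIdeal ℂ {x} ∈ HilbChart B) (i : Fin k) :
    hilbCoord B (b.1 + Finsupp.single i 1) b (MvPolynomial.vanishingIdeal ℂ {x}) = x i := by
  -- The difference of the i-th variable and the constant `x i` lies in the ideal, so multiplication
  -- by that variable is scalar on the quotient.
  have h : monClass (MvPolynomial.vanishingIdeal ℂ {x}) (b.1 + Finsupp.single i 1) =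
      x i • monClass (MvPolynomial.vanishingIdeal ℂ {x}) (b : Fin k →₀ ℕ) := by
    have : x i • monClass (MvPolynomial.vanishingIdeal ℂ {x}) (b : Fin k →₀ ℕ) =
      Ideal.Quotient.mk _ (x i • MvPolynomial.monomial (b : Fin k →₀ ℕ) (1 : ℂ)) := rfl
    rw [this, monClass, Ideal.Quotient.eq, MvPolynomial.mem_vanishingIdeal_iff]
    rintro y rfl
    simp only [MvPolynomial.smul_eq_C_mul, map_sub, map_mul, MvPolynomial.aeval_eq_eval]
    rw [add_comm, MvPolynomial.monomial_single_add]
    simp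
  rw [hilbCoord, dif_pos hI, h, map_smul, Finsupp.smul_apply]
  have hb := Module.Basis.repr_self (Module.Basis.mk hI.1 hI.2) b
  rw [Module.Basis.mk_apply] at hb
  rw [hb]
  simp

theorem HilbChart.nonempty {k n : ℕ} (hn : 0 < n) {B : Finset (Fin k →₀ ℕ)} (I : HilbPt k n)
    (hI : I.1 ∈ HilbChart B) : Nonempty B := by
  by_contra hB
  rw [not_nonempty_iff] at hB
  have h := hI.2
  rw [Set.range_eq_empty, Submodule.span_empty, top_le_iff] at h
  have h0 := I.2.2
  rw [← finrank_top, ← h, finrank_bot] at h0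
  omega

/-- A holomorphic family of points has holomorphic coordinate functions. -/
theorem exists_coordinate_of_isHolomorphicFamily {k n : ℕ} (hn : 0 < n) {E : Type*}
    [NormedAddCommGroup E] [NormedSpace ℂ E] {M : Type*} [TopologicalSpace M] [ChartedSpace E M]
    {J : M → HilbPt k n} (hJ : IsHolomorphicFamily (E := E) J) (x₀ : M) (i : Fin k) :
    ∃ U ∈ 𝓝 x₀, ∃ G : M → ℂ, ContMDiffOn 𝓘(ℂ, E) 𝓘(ℂ) ω G U ∧
      ∀ x ∈ U, ∀ y : Fin k → ℂ, (J x).1 = MvPolynomial.vanishingIdeal ℂ {y} → G x = y i := by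
  obtain ⟨B, U, hU, hchart, hcoord⟩ := hJ x₀
  obtain ⟨b⟩ := HilbChart.nonempty hn (J x₀) (hchart x₀ (mem_of_mem_nhds hU))
  refine ⟨U, hU, _, hcoord (b.1 + Finsupp.single i 1) b, fun x hx y hy => ?_⟩
  have := hchart x hx
  rw [hy] at this ⊢
  exact hilbCoord_vanishingIdeal_singleton b y this i

/-- A resolution of the fibre over the flag has dimension at least `k (k + 1) / 2`. -/
theorem IsEquivariantResolution.finrank_ge {k : ℕ} {E : Type*} [NormedAddCommGroup E]
    [NormedSpace ℂ E] [FiniteDimensional ℂ E] {M : Type*} [TopologicalSpace M]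
    [ChartedSpace E M] [IsManifold 𝓘(ℂ, E) ω M] [MulAction (Torus k) M]
    {π : M → NestedProduct k} (hπ : IsEquivariantResolution E π) :
    k * (k + 1) / 2 ≤ Module.finrank ℂ E := by
  obtain ⟨g, W, s, hW, ⟨p, hp⟩, hs, hconf, -, -⟩ := hπ.birational
  have hWo : IsOpen W := by
    have h1 : IsOpen {q : FlaggedConfig k | AffineIndependent ℂ q.1} :=
      (isOpen_setOfPred_affineIndependent (𝕜 := ℂ)).preimage continuous_subtype_val
    have hc : Continuous fun (q : FlaggedConfig k) (ji : Fin (k + 1) × Fin k) => q.1 ji.1 ji.2 :=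
      continuous_pi fun ji =>
        (continuous_apply ji.2).comp ((continuous_apply ji.1).comp continuous_subtype_val)
    have h2 : Continuous fun q : FlaggedConfig k =>
        MvPolynomial.eval (fun ji : Fin (k + 1) × Fin k => q.1 ji.1 ji.2) g :=
      (MvPolynomial.continuous_eval g).comp hc
    rw [hW]
    exact h1.inter (isOpen_ne.preimage h2)
  have hWp : W ∈ 𝓝 p := hWo.mem_nhds hp
  have hsp : ContMDiffAt 𝓘(ℂ, FlaggedConfig k) 𝓘(ℂ, E) ω s p := hs.contMDiffAt hWp
  have hsd : MDifferentiableAt 𝓘(ℂ, FlaggedConfig k) 𝓘(ℂ, E) s p :=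
    hsp.mdifferentiableAt (by simp)
  let L : FlaggedConfig k →L[ℂ] E := mfderiv 𝓘(ℂ, FlaggedConfig k) 𝓘(ℂ, E) s p
  refine (finrank_flaggedConfig_ge k).trans
    (LinearMap.finrank_le_finrank_of_injective (f := (L : FlaggedConfig k →ₗ[ℂ] E)) ?_)
  rw [injective_iff_map_eq_zero]
  intro v hv
  ext j i
  let c : FlaggedConfig k →L[ℂ] ℂ :=
    (ContinuousLinearMap.proj i).comp
      ((ContinuousLinearMap.proj (φ := fun _ : Fin (k + 1) => Fin k → ℂ) j).comp
        (FlaggedConfig k).subtypeL)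
  obtain ⟨U, hU, G, hG, hGy⟩ := exists_coordinate_of_isHolomorphicFamily
    (by simp : 0 < ({j} : Finset (Fin (k + 1))).card) (hπ.holomorphic {j}) (s p) i
  -- The singleton component {j} of the Hilbert data returns the point p_j, so `G` is a local left
  -- inverse of `s` in each coordinate. By the chain rule a vector killed by the differential of `s`
  -- has all coordinates zero.
  have heq : G ∘ s =ᶠ[𝓝 p] c := by
    filter_upwards [hWp, hsp.continuousAt hU] with q hq hqU
    refine hGy (s q) hqU (q.1 j) ?_
    simpa using hconf q hq {j}
  have hGd : MDifferentiableAt 𝓘(ℂ, E) 𝓘(ℂ) G (s p) :=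
    (hG.contMDiffAt hU).mdifferentiableAt (by simp)
  have h1 := heq.mfderiv_eq (I := 𝓘(ℂ, FlaggedConfig k)) (I' := 𝓘(ℂ))
  rw [mfderiv_comp p hGd hsd, mfderiv_eq_fderiv, c.fderiv] at h1
  have h2 := congrArg (fun T : FlaggedConfig k →L[ℂ] ℂ => T v) h1
  let T : E →L[ℂ] ℂ := mfderiv 𝓘(ℂ, E) 𝓘(ℂ) G (s p)
  have h3 : T (L v) = c v := h2
  have h4 : L v = 0 := hv
  rw [h4, map_zero] at h3
  exact h3.symm

/-! ### Tangent weights at isolated fixed points are nonzero -/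

theorem expTorus_add {k : ℕ} (s s' : Fin k → ℂ) :
    expTorus (s + s') = expTorus s * expTorus s' := by
  funext j
  ext
  simp [expTorus, Complex.exp_add]

theorem expTorus_zero {k : ℕ} : expTorus (0 : Fin k → ℂ) = 1 := by
  funext j
  ext
  simp [expTorus]

theorem exists_expTorus_eq {k : ℕ} (t : Torus k) : ∃ s, expTorus s = t := by
  refine ⟨fun j => Complex.log (t j), ?_⟩
  funext j
  ext
  simp [expTorus, Complex.exp_log]

/-- The values at `t` of the characters with weights `χ`. -/
def torusWeight {k n : ℕ} (χ : Fin n → Fin k → ℤ) (t : Torus k) : Fin n → ℂ :=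
  fun i => ∏ j, (t j : ℂ) ^ χ i j

theorem torusWeight_mul {k n : ℕ} (χ : Fin n → Fin k → ℤ) (s t : Torus k) :
    torusWeight χ (s * t) = torusWeight χ s * torusWeight χ t := by
  funext i
  simp [torusWeight, mul_zpow, Finset.prod_mul_distrib]

theorem torusWeight_one {k n : ℕ} (χ : Fin n → Fin k → ℤ) : torusWeight χ 1 = 1 := by
  funext i
  simp [torusWeight]

theorem torusWeight_inv_expTorus {k n : ℕ} (χ : Fin n → Fin k → ℤ) (s : Fin k → ℂ) :
    torusWeight χ (expTorus s)⁻¹ = fun i => Complex.exp (-∑ j, (χ i j : ℂ) * s j) := by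
  funext i
  rw [← Finset.sum_neg_distrib, Complex.exp_sum]
  refine Finset.prod_congr rfl fun j _ => ?_
  simp [expTorus, ← Complex.exp_int_mul, Complex.exp_neg]

/-- The point of the compact torus with given angles. -/
def angleTorus {k : ℕ} (x : Fin k → AddCircle (2 * Real.pi)) : Torus k :=
  fun j => Circle.toUnits (AddCircle.toCircle (x j))

theorem coe_angleTorus {k : ℕ} (x : Fin k → AddCircle (2 * Real.pi)) (j : Fin k) :
    (angleTorus x j : ℂ) = AddCircle.toCircle (x j) := rfl

theorem angleTorus_add {k : ℕ} (x y : Fin k → AddCircle (2 * Real.pi)) :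
    angleTorus (x + y) = angleTorus x * angleTorus y := by
  funext j
  ext
  simp [coe_angleTorus, AddCircle.toCircle_add]

theorem angleTorus_coe {k : ℕ} (θ : Fin k → ℝ) :
    angleTorus (fun j => (θ j : AddCircle (2 * Real.pi))) =
      expTorus (fun j => θ j * Complex.I) := by
  funext j
  ext
  simp [coe_angleTorus, expTorus, AddCircle.toCircle_apply_mk]

/-- The compact torus is the image under `exp` of a compact set. -/
theorem exists_expTorus_eq_angleTorus {k : ℕ} (x : Fin k → AddCircle (2 * Real.pi)) :
    ∃ s ∈ Metric.closedBall (0 : Fin k → ℂ) Real.pi, expTorus s = angleTorus x := by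
  refine ⟨fun j => Complex.arg (AddCircle.toCircle (x j)) * Complex.I, ?_, ?_⟩
  · rw [mem_closedBall_zero_iff, pi_norm_le_iff_of_nonneg Real.pi_pos.le]
    intro j
    simpa using Complex.abs_arg_le_pi _
  · funext j
    ext
    have := Complex.norm_mul_exp_arg_mul_I (AddCircle.toCircle (x j) : ℂ)
    rw [Circle.norm_coe, Complex.ofReal_one, one_mul] at this
    simpa [coe_angleTorus, expTorus] using this

theorem continuous_torusWeight_inv_angleTorus {k n : ℕ} (χ : Fin n → Fin k → ℤ) :
    Continuous fun x : Fin k → AddCircle (2 * Real.pi) => torusWeight χ (angleTorus x)⁻¹ := by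
  refine continuous_pi fun i => continuous_finsetProd _ fun j _ => ?_
  simp only [Pi.inv_apply, Units.val_inv_eq_inv_val, coe_angleTorus]
  have hc : Continuous fun x : Fin k → AddCircle (2 * Real.pi) =>
      (AddCircle.toCircle (x j) : ℂ) :=
    continuous_subtype_val.comp (AddCircle.continuous_toCircle.comp (continuous_apply j))
  have hne : ∀ x : Fin k → AddCircle (2 * Real.pi), (AddCircle.toCircle (x j) : ℂ) ≠ 0 :=
    fun x => Circle.coe_ne_zero _
  exact (hc.inv₀ hne).zpow₀ _ fun x => Or.inl (inv_ne_zero (hne x))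

/-! ### The torus action in charts, and passage from the compact to the full torus -/

section Action

variable {k : ℕ} {E : Type*} [NormedAddCommGroup E] [NormedSpace ℂ E]
  {M : Type*} [TopologicalSpace M] [ChartedSpace E M] [MulAction (Torus k) M]

/-- Continuity is checked after pulling back along the open quotient map from ℝ^k, where the action
factors through `expTorus`. -/
theorem continuous_angleTorus_smul
    (hact : Continuous fun q : (Fin k → ℂ) × M => expTorus q.1 • q.2) (y : M) :
    Continuous fun x : Fin k → AddCircle (2 * Real.pi) => angleTorus x • y := by
  have hq : IsOpenQuotientMap (Pi.map fun (_ : Fin k) (θ : ℝ) => (θ : AddCircle (2 * Real.pi))) :=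
    IsOpenQuotientMap.piMap fun _ => QuotientAddGroup.isOpenQuotientMap_mk
  rw [← hq.continuous_comp_iff]
  have : ((fun x : Fin k → AddCircle (2 * Real.pi) => angleTorus x • y) ∘
      (Pi.map fun (_ : Fin k) (θ : ℝ) => (θ : AddCircle (2 * Real.pi)))) =
      fun θ => expTorus (fun j => (θ j : ℂ) * Complex.I) • y := by
    funext θ
    exact congrArg (· • y) (angleTorus_coe θ)
  rw [this]
  refine hact.comp (Continuous.prodMk ?_ continuous_const)
  fun_prop

/-- As F is fixed, the same chart serves at source and target, so the manifold derivative is an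
ordinary derivative. -/
theorem hasFDerivAt_chart_smul_symm
    (hact : ContMDiff (𝓘(ℂ, Fin k → ℂ).prod 𝓘(ℂ, E)) 𝓘(ℂ, E) ω
      (fun q : (Fin k → ℂ) × M => expTorus q.1 • q.2)) {F : M} (hF : ∀ t : Torus k, t • F = F)
    (t : Torus k) {T : E →L[ℂ] E}
    (hT : mfderiv 𝓘(ℂ, E) 𝓘(ℂ, E) (fun x : M => t • x) F = T) :
    HasFDerivAt (fun e : E => chartAt E F (t • (chartAt E F).symm e)) T (chartAt E F F) := by
  obtain ⟨s, rfl⟩ := exists_expTorus_eq t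
  have h1 : MDifferentiableAt 𝓘(ℂ, E) 𝓘(ℂ, E) (fun x : M => expTorus s • x) F := by
    have h2 : ContMDiff 𝓘(ℂ, E) 𝓘(ℂ, E) ω (fun x : M => expTorus s • x) :=
      hact.comp (contMDiff_const.prodMk contMDiff_id)
    exact (h2 F).mdifferentiableAt (by simp)
  have h3 : HasMFDerivAt 𝓘(ℂ, E) 𝓘(ℂ, E) (fun x : M => expTorus s • x) F T := by
    rw [← hT]
    exact h1.hasMFDerivAt
  have h4 := h3.2
  simp only [writtenInExtChartAt, hF, Function.comp_def, mfld_simps] at h4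
  exact hasFDerivWithinAt_univ.1 h4

variable [IsManifold 𝓘(ℂ, E) ω M]

theorem contMDiffAt_chart_expTorus_smul
    (hact : ContMDiff (𝓘(ℂ, Fin k → ℂ).prod 𝓘(ℂ, E)) 𝓘(ℂ, E) ω
      (fun q : (Fin k → ℂ) × M => expTorus q.1 • q.2)) (F : M) {s : Fin k → ℂ} {y : M}
    (hy : expTorus s • y ∈ (chartAt E F).source) :
    ContMDiffAt (𝓘(ℂ, Fin k → ℂ).prod 𝓘(ℂ, E)) 𝓘(ℂ, E) ω
      (fun q : (Fin k → ℂ) × M => chartAt E F (expTorus q.1 • q.2)) (s, y) := by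
  have h1 : ContMDiffAt 𝓘(ℂ, E) 𝓘(ℂ, E) ω (extChartAt 𝓘(ℂ, E) F) (expTorus s • y) :=
    contMDiffAt_extChartAt' hy
  have h2 := ContMDiffAt.comp (s, y) h1 (hact (s, y))
  simpa [Function.comp_def] using h2

theorem contDiffAt_chart_expTorus_smul_symm
    (hact : ContMDiff (𝓘(ℂ, Fin k → ℂ).prod 𝓘(ℂ, E)) 𝓘(ℂ, E) ω
      (fun q : (Fin k → ℂ) × M => expTorus q.1 • q.2)) {F : M} (hF : ∀ t : Torus k, t • F = F)
    (s : Fin k → ℂ) :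
    ContDiffAt ℂ ω (fun p : (Fin k → ℂ) × E =>
      chartAt E F (expTorus p.1 • (chartAt E F).symm p.2)) (s, chartAt E F F) := by
  rw [← contMDiffAt_iff_contDiffAt]
  have hsymm : ContMDiffAt 𝓘(ℂ, E) 𝓘(ℂ, E) ω (chartAt E F).symm (chartAt E F F) := by
    have := (contMDiffOn_extChartAt_symm (I := 𝓘(ℂ, E)) (n := ω) F).contMDiffAt
      (extChartAt_target_mem_nhds (I := 𝓘(ℂ, E)) F)
    simpa using this
  have h1 : ContMDiffAt 𝓘(ℂ, (Fin k → ℂ) × E) (𝓘(ℂ, Fin k → ℂ).prod 𝓘(ℂ, E)) ω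
      (fun p : (Fin k → ℂ) × E => (p.1, (chartAt E F).symm p.2)) (s, chartAt E F F) := by
    refine ContMDiffAt.prodMk contDiff_fst.contMDiff.contMDiffAt ?_
    exact ContMDiffAt.comp (s, chartAt E F F) hsymm contDiff_snd.contMDiff.contMDiffAt
  have hFF : (chartAt E F).symm (chartAt E F F) = F :=
    (chartAt E F).left_inv (mem_chart_source E F)
  refine ContMDiffAt.comp (s, chartAt E F F)
    (g := fun q : (Fin k → ℂ) × M => chartAt E F (expTorus q.1 • q.2)) ?_ h1
  refine contMDiffAt_chart_expTorus_smul hact F ?_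
  simp only [hFF, hF, mem_chart_source]

/-- A point fixed by the compact torus is fixed by the whole torus. -/
theorem smul_eq_of_forall_angleTorus_smul_eq
    (hact : ContMDiff (𝓘(ℂ, Fin k → ℂ).prod 𝓘(ℂ, E)) 𝓘(ℂ, E) ω
      (fun q : (Fin k → ℂ) × M => expTorus q.1 • q.2)) {y : M}
    (hy : ∀ x : Fin k → AddCircle (2 * Real.pi), angleTorus x • y = y) (t : Torus k) : t • y = y := by
  have hI : ∀ v : Fin k → ℝ, expTorus (fun j => (v j : ℂ) * Complex.I) • y = y := fun v => by
    rw [← angleTorus_coe]; exact hy _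
  have hR : ∀ v : Fin k → ℝ, expTorus (fun j => (v j : ℂ)) • y = y := by
    intro v
    -- A complex one-parameter subgroup whose imaginary axis lies in the compact torus and whose
    -- value at 1 is the wanted real element.
    set γ : ℂ → Torus k := fun z => expTorus fun j => z * v j with hγ
    have hγ0 : γ 0 • y = y := by
      have : γ 0 = 1 := by
        rw [← expTorus_zero]
        simp only [hγ, zero_mul]
        rfl
      rw [this, one_smul]
    have hcont : ContMDiffAt 𝓘(ℂ) (𝓘(ℂ, Fin k → ℂ).prod 𝓘(ℂ, E)) ω
        (fun z : ℂ => ((fun j => z * v j : Fin k → ℂ), y)) 0 := by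
      refine ContMDiffAt.prodMk (ContDiffAt.contMDiffAt ?_) contMDiffAt_const
      fun_prop
    have hsrc : expTorus (fun j => (0 : ℂ) * v j) • y ∈ (chartAt E y).source := by
      have : γ 0 • y ∈ (chartAt E y).source := by rw [hγ0]; exact mem_chart_source E y
      exact this
    have han : AnalyticAt ℂ (fun z : ℂ => chartAt E y (γ z • y)) 0 := by
      refine ContDiffAt.analyticAt (contMDiffAt_iff_contDiffAt.1 ?_)
      exact ContMDiffAt.comp
        (g := fun q : (Fin k → ℂ) × M => chartAt E y (expTorus q.1 • q.2))
        (f := fun z : ℂ => ((fun j => z * v j : Fin k → ℂ), y)) (0 : ℂ)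
        (contMDiffAt_chart_expTorus_smul hact y hsrc) hcont
    have hev : ∀ᶠ z in 𝓝 (0 : ℂ), chartAt E y (γ z • y) = chartAt E y y := by
      -- Identity theorem: equality holds on the imaginary axis, which accumulates at 0.
      refine (AnalyticAt.frequently_eq_iff_eventually_eq han analyticAt_const).1 ?_
      have htend : Filter.Tendsto (fun a : ℝ => (a : ℂ) * Complex.I) (𝓝[≠] 0) (𝓝[≠] 0) := by
        refine tendsto_nhdsWithin_iff.2 ⟨?_, ?_⟩
        · have : Continuous fun a : ℝ => (a : ℂ) * Complex.I := by fun_prop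
          have h0 := this.tendsto 0
          simp only [Complex.ofReal_zero, zero_mul] at h0
          exact h0.mono_left nhdsWithin_le_nhds
        · filter_upwards [self_mem_nhdsWithin] with a ha
          simpa using ha
      refine htend.frequently (Filter.Eventually.frequently (Filter.Eventually.of_forall ?_))
      intro a
      have h1 := hI fun j => a * v j
      have h2 : γ ((a : ℂ) * Complex.I) =
          expTorus (fun j => ((a * v j : ℝ) : ℂ) * Complex.I) := by
        simp only [hγ, Complex.ofReal_mul]
        congr 1
        funext j
        ring
      rw [h2, h1]
    have hev2 : ∀ᶠ z in 𝓝 (0 : ℂ), γ z • y = y := by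
      have hc : ContinuousAt (fun z : ℂ => γ z • y) 0 :=
        (hact.continuous.continuousAt.comp hcont.continuousAt)
      have hs : (chartAt E y).source ∈ 𝓝 (γ 0 • y) := by
        rw [hγ0]; exact chart_source_mem_nhds E y
      filter_upwards [hev, hc hs] with z hz hz'
      exact (chartAt E y).injOn hz' (mem_chart_source E y) hz
    -- The stabilizer contains γ(1/(N+1)) for some N, hence its (N+1)-st power γ(1).
    have hlim : Filter.Tendsto (fun N : ℕ => ((N : ℂ) + 1)⁻¹) Filter.atTop (𝓝 0) := by
      have := tendsto_one_div_add_atTop_nhds_zero_nat (𝕜 := ℂ)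
      simpa using this
    obtain ⟨N, hN⟩ := (hlim.eventually hev2).exists
    have hpow : ∀ j : ℕ, γ (j * ((N : ℂ) + 1)⁻¹) • y = y := by
      intro j
      induction j with
      | zero => simpa using hγ0
      | succ j ih =>
        have : γ (((j + 1 : ℕ) : ℂ) * ((N : ℂ) + 1)⁻¹) =
            γ (((N : ℂ) + 1)⁻¹) * γ (j * ((N : ℂ) + 1)⁻¹) := by
          simp only [hγ, ← expTorus_add]
          congr 1
          funext i
          simp only [Pi.add_apply]
          push_cast
          ring
        rw [this, mul_smul, ih, hN]
    have h1 := hpow (N + 1)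
    have hN0 : (N : ℂ) + 1 ≠ 0 := by exact_mod_cast Nat.succ_ne_zero N
    rw [Nat.cast_succ, mul_inv_cancel₀ hN0] at h1
    simpa [hγ] using h1
  obtain ⟨s, rfl⟩ := exists_expTorus_eq t
  have hs : s = (fun j => ((s j).re : ℂ)) + fun j => ((s j).im : ℂ) * Complex.I := by
    funext j
    exact (Complex.re_add_im (s j)).symm
  rw [hs, expTorus_add, mul_smul, hI fun j => (s j).im, hR fun j => (s j).re]

end Action

/-- A tube lemma: the compact torus is covered by `expTorus` of a closed ball, and the action is
jointly continuous and fixes F. -/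
theorem eventually_angleTorus_smul_symm_mem {k : ℕ} {E : Type*} [NormedAddCommGroup E]
    {M : Type*} [TopologicalSpace M] [ChartedSpace E M] [MulAction (Torus k) M]
    (hact : Continuous fun q : (Fin k → ℂ) × M => expTorus q.1 • q.2) {F : M} (hF : ∀ t : Torus k, t • F = F)
    {U : Set M} (hU : U ∈ 𝓝 F) :
    ∀ᶠ e in 𝓝 (chartAt E F F), ∀ x : Fin k → AddCircle (2 * Real.pi),
      angleTorus x • (chartAt E F).symm e ∈ U := by
  have h : ∀ᶠ e in 𝓝 (chartAt E F F), ∀ s ∈ Metric.closedBall (0 : Fin k → ℂ) Real.pi,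
      expTorus s • (chartAt E F).symm e ∈ U := by
    refine (isCompact_closedBall _ _).eventually_forall_of_forall_eventually fun s _ => ?_
    have hsymm : ContinuousAt (chartAt E F).symm (chartAt E F F) :=
      (chartAt E F).continuousAt_symm (mem_chart_target E F)
    have hc : ContinuousAt (fun z : E × (Fin k → ℂ) => expTorus z.2 • (chartAt E F).symm z.1)
        (chartAt E F F, s) :=
      hact.continuousAt.comp
        (f := fun z : E × (Fin k → ℂ) => (z.2, (chartAt E F).symm z.1))
        (continuousAt_snd.prodMk
          (ContinuousAt.comp (f := Prod.fst) hsymm continuousAt_fst))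
    refine hc ?_
    simp only [(chartAt E F).left_inv (mem_chart_source E F), hF]
    exact hU
  filter_upwards [h] with e he x
  obtain ⟨s, hs, hsx⟩ := exists_expTorus_eq_angleTorus x
  rw [← hsx]
  exact he s hs

/-! ### Linearizing the action by averaging over the compact torus -/

section Linearization

variable {k n : ℕ} {E : Type*} [NormedAddCommGroup E] [NormedSpace ℂ E]
  {M : Type*} [TopologicalSpace M] [ChartedSpace E M] [MulAction (Torus k) M]

/-- The chart at `F`, in linear coordinates `L`, precomposed with `t` and twisted so that its
average over the compact torus is equivariant for the characters `χ`. -/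
def twistedChart (χ : Fin n → Fin k → ℤ) (L : E ≃L[ℂ] (Fin n → ℂ)) (F : M) (t : Torus k) (y : M) :
    Fin n → ℂ :=
  torusWeight χ t⁻¹ * L (chartAt E F (t • y) - chartAt E F F)

theorem twistedChart_smul (χ : Fin n → Fin k → ℤ) (L : E ≃L[ℂ] (Fin n → ℂ)) (F : M)
    (s t : Torus k) (y : M) :
    twistedChart χ L F s (t • y) = torusWeight χ t * twistedChart χ L F (s * t) y := by
  rw [twistedChart, twistedChart, ← mul_assoc, ← torusWeight_mul, mul_smul]
  congr 2
  rw [mul_inv, mul_comm s⁻¹, mul_inv_cancel_left]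

open MeasureTheory in
/-- Haar probability measure on the angles of the compact torus. -/
def angleHaar (k : ℕ) : Measure (Fin k → AddCircle (2 * Real.pi)) :=
  Measure.pi fun _ => AddCircle.haarAddCircle

open MeasureTheory in
instance isProbabilityMeasure_angleHaar : IsProbabilityMeasure (angleHaar k) := by
  unfold angleHaar; infer_instance

open MeasureTheory in
instance isAddRightInvariant_angleHaar : (angleHaar k).IsAddRightInvariant := by
  unfold angleHaar; infer_instance

/-- The average over the compact torus of the twisted translates of the chart at `F`. -/
def averagedChart (χ : Fin n → Fin k → ℤ) (L : E ≃L[ℂ] (Fin n → ℂ)) (F y : M) : Fin n → ℂ :=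
  ∫ x, twistedChart χ L F (angleTorus x) y ∂angleHaar k

/-- The cocycle rule `twistedChart_smul` takes the character out of the integral, and invariance of
Haar measure absorbs the remaining translation. -/
theorem averagedChart_smul (χ : Fin n → Fin k → ℤ) (L : E ≃L[ℂ] (Fin n → ℂ)) (F y : M)
    (a : Fin k → AddCircle (2 * Real.pi))
    (hint : MeasureTheory.Integrable (fun x => twistedChart χ L F (angleTorus x) y)
      (angleHaar k)) :
    averagedChart χ L F (angleTorus a • y) =
      torusWeight χ (angleTorus a) * averagedChart χ L F y := by
  have h1 := ((ContinuousLinearMap.mul ℂ (Fin n → ℂ))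
    (torusWeight χ (angleTorus a))).integral_comp_comm (hint.comp_add_right a)
  simp only [ContinuousLinearMap.mul_apply'] at h1
  rw [averagedChart, averagedChart,
    ← MeasureTheory.integral_add_right_eq_self
      (fun x => twistedChart χ L F (angleTorus x) y) a, ← h1]
  simp only [twistedChart_smul, angleTorus_add]

theorem integrable_twistedChart
    (hact : Continuous fun q : (Fin k → ℂ) × M => expTorus q.1 • q.2)
    (χ : Fin n → Fin k → ℤ) (L : E ≃L[ℂ] (Fin n → ℂ)) (F : M) {y : M}
    (hy : ∀ x : Fin k → AddCircle (2 * Real.pi), angleTorus x • y ∈ (chartAt E F).source) :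
    MeasureTheory.Integrable (fun x => twistedChart χ L F (angleTorus x) y) (angleHaar k) := by
  refine Continuous.integrable_of_hasCompactSupport ?_ (HasCompactSupport.of_compactSpace _)
  refine (continuous_torusWeight_inv_angleTorus χ).mul (L.continuous.comp ?_)
  refine Continuous.sub ?_ continuous_const
  exact (chartAt E F).continuousOn.comp_continuous (continuous_angleTorus_smul hact y) hy

variable [IsManifold 𝓘(ℂ, E) ω M]

/-- The twist cancels the tangent action, so every twisted translate has the same derivative `L` at
F. Strict differentiability jointly in the parameter and the point makes the estimate locally
uniform in `s`, as needed for integration over the compact torus. -/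
theorem eventually_twistedChart_sub_le [FiniteDimensional ℂ E]
    (hact : ContMDiff (𝓘(ℂ, Fin k → ℂ).prod 𝓘(ℂ, E)) 𝓘(ℂ, E) ω
      (fun q : (Fin k → ℂ) × M => expTorus q.1 • q.2)) {F : M} (hF : ∀ t : Torus k, t • F = F)
    {χ : Fin n → Fin k → ℤ} (b : Module.Basis (Fin n) ℂ E)
    (hb : ∀ (t : Torus k) (i : Fin n),
      (mfderiv 𝓘(ℂ, E) 𝓘(ℂ, E) (fun x : M => t • x) F : E →L[ℂ] E) (b i) =
        (∏ j, (t j : ℂ) ^ χ i j) • b i)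
    (s : Fin k → ℂ) {c : ℝ} (hc : 0 < c) :
    ∀ᶠ q : (E × E) × (Fin k → ℂ) in 𝓝 ((chartAt E F F, chartAt E F F), s),
      ‖twistedChart χ b.equivFunL F (expTorus q.2) ((chartAt E F).symm q.1.1) -
        twistedChart χ b.equivFunL F (expTorus q.2) ((chartAt E F).symm q.1.2) -
        b.equivFunL (q.1.1 - q.1.2)‖ ≤ c * ‖q.1.1 - q.1.2‖ := by
  set e₀ := chartAt E F F with he₀
  set L := b.equivFunL with hL
  let Q : (Fin k → ℂ) × E → E := fun p => chartAt E F (expTorus p.1 • (chartAt E F).symm p.2)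
  let g : (Fin k → ℂ) × E → Fin n → ℂ := fun p =>
    twistedChart χ L F (expTorus p.1) ((chartAt E F).symm p.2)
  have hQ : ContDiffAt ℂ ω Q (s, e₀) := contDiffAt_chart_expTorus_smul_symm hact hF s
  have hgeq : g = fun p => (fun i => Complex.exp (-∑ j, (χ i j : ℂ) * p.1 j)) * L (Q p - e₀) := by
    funext p
    simp only [g, twistedChart, torusWeight_inv_expTorus]
    rfl
  have hg : ContDiffAt ℂ ω g (s, e₀) := by
    rw [hgeq]
    refine ContDiffAt.mul ?_ ?_
    · refine ContDiff.contDiffAt (contDiff_pi.2 fun i => ?_)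
      fun_prop
    · exact L.contDiff.contDiffAt.comp _ (hQ.sub contDiffAt_const)
  have hstrict := hg.hasStrictFDerivAt (by simp)
  set D := fderiv ℂ g (s, e₀) with hD
  have hDL : ∀ v, D (0, v) = L v := by
    let T : E →L[ℂ] E := mfderiv 𝓘(ℂ, E) 𝓘(ℂ, E) (fun x : M => expTorus s • x) F
    have hT : HasFDerivAt (fun e : E => Q (s, e)) T e₀ :=
      hasFDerivAt_chart_smul_symm hact hF (expTorus s) rfl
    have h1 : HasFDerivAt (fun e : E => g (s, e)) (D.comp (ContinuousLinearMap.inr ℂ _ E)) e₀ :=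
      hstrict.hasFDerivAt.comp e₀ (hasFDerivAt_prodMk_right s e₀)
    have h2 : HasFDerivAt (fun e : E => g (s, e))
        (((ContinuousLinearMap.mul ℂ (Fin n → ℂ)) (torusWeight χ (expTorus s)⁻¹)).comp
          ((L : E →L[ℂ] (Fin n → ℂ)).comp T)) e₀ :=
      ((ContinuousLinearMap.mul ℂ (Fin n → ℂ)) (torusWeight χ (expTorus s)⁻¹)).hasFDerivAt.comp e₀
        ((L : E →L[ℂ] (Fin n → ℂ)).hasFDerivAt.comp e₀ (hT.sub_const e₀))
    have h3 := h1.unique h2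
    have h4 : (D.comp (ContinuousLinearMap.inr ℂ (Fin k → ℂ) E) : E →ₗ[ℂ] (Fin n → ℂ)) =
        (L : E →L[ℂ] (Fin n → ℂ)) := by
      refine b.ext fun i => ?_
      rw [h3]
      have hTb : T (b i) = torusWeight χ (expTorus s) i • b i := hb (expTorus s) i
      have hLb : L (b i) = Pi.single i 1 := by
        funext j
        simp [hL, Module.Basis.equivFunL, Pi.single_apply, eq_comm]
      have hw : torusWeight χ (expTorus s)⁻¹ i * torusWeight χ (expTorus s) i = 1 := by
        rw [← Pi.mul_apply, ← torusWeight_mul, inv_mul_cancel, torusWeight_one, Pi.one_apply]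
      simp only [ContinuousLinearMap.coe_coe, ContinuousLinearMap.comp_apply,
        ContinuousLinearMap.mul_apply', hTb, map_smul, ContinuousLinearEquiv.coe_coe, hLb]
      funext j
      by_cases hj : j = i
      · subst hj
        simpa [mul_comm] using hw
      · simp [hj]
    intro v
    exact congrArg (fun f : E →ₗ[ℂ] (Fin n → ℂ) => f v) h4
  have hlin := hstrict.isLittleO.def hc
  -- The two points compared share the parameter, so only the derivative in the direction of E
  -- enters.
  have htend : Filter.Tendsto
      (fun q : (E × E) × (Fin k → ℂ) => (((q.2, q.1.1), (q.2, q.1.2)) :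
        ((Fin k → ℂ) × E) × ((Fin k → ℂ) × E)))
      (𝓝 ((e₀, e₀), s)) (𝓝 ((s, e₀), (s, e₀))) := by
    refine Continuous.tendsto' (by fun_prop) _ _ rfl
  filter_upwards [htend.eventually hlin] with q hq
  simp only [Prod.mk_sub_mk, sub_self, hDL] at hq
  simpa [g, Prod.norm_def] using hq

/-- Near an isolated torus-fixed point the averaged chart is a local coordinate system linearizing
the action of the compact torus, so that no tangent weight vanishes. -/
theorem tangentWeight_ne_zero [FiniteDimensional ℂ E]
    (hact : ContMDiff (𝓘(ℂ, Fin k → ℂ).prod 𝓘(ℂ, E)) 𝓘(ℂ, E) ω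
      (fun q : (Fin k → ℂ) × M => expTorus q.1 • q.2)) {F : M} (hF : IsIsolatedFixedPoint k F)
    {χ : Fin (Module.finrank ℂ E) → Fin k → ℤ} (hχ : IsTangentWeights E F χ)
    (i : Fin (Module.finrank ℂ E)) : χ i ≠ 0 := by
  intro hi
  obtain ⟨b, hb⟩ := hχ
  obtain ⟨hfix, U, hU, hiso⟩ := hF
  have : Nontrivial E := Module.nontrivial_of_finrank_pos (R := ℂ) (Fin.pos i)
  set e₀ := chartAt E F F with he₀
  set L := b.equivFunL with hL
  have hN : 0 < ‖(L.symm : (Fin (Module.finrank ℂ E) → ℂ) →L[ℂ] E)‖₊ := L.nnnorm_symm_pos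
  -- Below ‖L⁻¹‖⁻¹ the inverse function theorem applies to maps `c`-close to `L`.
  obtain ⟨c, hc0, hcN⟩ := exists_between (inv_pos.2 hN)
  -- the averaged chart is close to its linear part near `F`
  have hlip : ∀ᶠ q : E × E in 𝓝 (e₀, e₀), ∀ s ∈ Metric.closedBall (0 : Fin k → ℂ) Real.pi,
      ‖twistedChart χ L F (expTorus s) ((chartAt E F).symm q.1) -
        twistedChart χ L F (expTorus s) ((chartAt E F).symm q.2) - L (q.1 - q.2)‖ ≤
        c * ‖q.1 - q.2‖ :=
    (isCompact_closedBall _ _).eventually_forall_of_forall_eventually fun s _ =>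
      eventually_twistedChart_sub_le hact hfix b hb s (by exact_mod_cast hc0)
  have hsrc := eventually_angleTorus_smul_symm_mem (E := E) hact.continuous hfix (chart_source_mem_nhds E F)
  rw [nhds_prod_eq, Filter.eventually_prod_self_iff'] at hlip
  obtain ⟨B, hB, hBlip⟩ := hlip
  obtain ⟨B', hB', hBsrc⟩ := hsrc.exists_mem
  have hint : ∀ e ∈ B', MeasureTheory.Integrable
      (fun x => twistedChart χ L F (angleTorus x) ((chartAt E F).symm e)) (angleHaar k) :=
    fun e he => integrable_twistedChart hact.continuous χ L F (hBsrc e he)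
  let Ψ : E → Fin (Module.finrank ℂ E) → ℂ := fun e => averagedChart χ L F ((chartAt E F).symm e)
  have happrox : ApproximatesLinearOn Ψ (L : E →L[ℂ] (Fin (Module.finrank ℂ E) → ℂ))
      (B ∩ B') c := by
    rintro e ⟨he, he'⟩ f ⟨hf, hf'⟩
    have h1 : Ψ e - Ψ f - L (e - f) = ∫ x, (twistedChart χ L F (angleTorus x)
        ((chartAt E F).symm e) - twistedChart χ L F (angleTorus x) ((chartAt E F).symm f) -
          L (e - f)) ∂angleHaar k := by
      have hsub : MeasureTheory.Integrable (fun x => twistedChart χ L F (angleTorus x)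
          ((chartAt E F).symm e) - twistedChart χ L F (angleTorus x) ((chartAt E F).symm f))
          (angleHaar k) := (hint e he').sub (hint f hf')
      rw [MeasureTheory.integral_sub hsub (MeasureTheory.integrable_const _), MeasureTheory.integral_sub (hint e he') (hint f hf')]
      simp [Ψ, averagedChart]
    rw [ContinuousLinearEquiv.coe_coe, h1]
    refine (MeasureTheory.norm_integral_le_of_norm_le_const
      (Filter.Eventually.of_forall fun x => ?_)).trans_eq (by rw [MeasureTheory.probReal_univ,
        mul_one])
    obtain ⟨s, hs, hsx⟩ := exists_expTorus_eq_angleTorus x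
    rw [← hsx]
    exact hBlip e he f hf s hs
  have hinj : Set.InjOn Ψ (B ∩ B') := happrox.injOn (Or.inr hcN)
  have hopen : Filter.map Ψ (𝓝 e₀) = 𝓝 (Ψ e₀) :=
    happrox.map_nhds_eq L.toNonlinearRightInverse (Filter.inter_mem hB hB') (Or.inr hcN)
  have hsymm₀ : (chartAt E F).symm e₀ = F := (chartAt E F).left_inv (mem_chart_source E F)
  have hΨ₀ : Ψ e₀ = 0 := by
    simp only [Ψ, averagedChart, twistedChart, hsymm₀, hfix, sub_self, map_zero, mul_zero,
      MeasureTheory.integral_zero]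
  -- points near `F` on the axis of the zero weight
  have hV : (chartAt E F).source ∩ chartAt E F ⁻¹' (B ∩ B') ∩ U ∈ 𝓝 F := by
    refine Filter.inter_mem (Filter.inter_mem (chart_source_mem_nhds E F) ?_) hU
    exact (chartAt E F).continuousAt (mem_chart_source E F) (Filter.inter_mem hB hB')
  have hgood := eventually_angleTorus_smul_symm_mem (E := E) hact.continuous hfix hV
  have htarget : ∀ᶠ e in 𝓝 e₀, e ∈ (chartAt E F).target := chart_target_mem_nhds E F
  have himage : Ψ '' {e | (∀ x : Fin k → AddCircle (2 * Real.pi),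
      angleTorus x • (chartAt E F).symm e ∈
        (chartAt E F).source ∩ chartAt E F ⁻¹' (B ∩ B') ∩ U) ∧ e ∈ (chartAt E F).target ∧
      e ∈ B ∩ B'} ∈ 𝓝 (0 : Fin (Module.finrank ℂ E) → ℂ) := by
    rw [← hΨ₀, ← hopen]
    refine Filter.image_mem_map ?_
    filter_upwards [hgood, htarget, hB, hB'] with e h1 h2 h3 h4 using ⟨h1, h2, h3, h4⟩
  have hline : Filter.Tendsto (fun u : ℂ => (Pi.single i u : Fin (Module.finrank ℂ E) → ℂ))
      (𝓝[≠] 0) (𝓝 0) := by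
    have h1 : Continuous fun u : ℂ => (Pi.single i u : Fin (Module.finrank ℂ E) → ℂ) :=
      (ContinuousLinearMap.single ℂ (fun _ => ℂ) i).continuous
    have h2 := h1.tendsto 0
    rw [Pi.single_zero] at h2
    exact h2.mono_left nhdsWithin_le_nhds
  -- A point whose averaged coordinates are (0, …, u, …, 0) with u ≠ 0 in place `i`.
  obtain ⟨u, ⟨e, ⟨heV, het, heB⟩, heu⟩, hu⟩ :=
    ((hline.eventually himage).and self_mem_nhdsWithin).exists
  have hcompact : ∀ a : Fin k → AddCircle (2 * Real.pi),
      angleTorus a • (chartAt E F).symm e = (chartAt E F).symm e := by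
    intro a
    obtain ⟨⟨ha1, ha2⟩, -⟩ := heV a
    -- By equivariance the torus multiplies the i-th coordinate by a trivial character and the
    -- others are zero; injectivity of `Ψ` then makes the point fixed.
    have h1 : Ψ (chartAt E F (angleTorus a • (chartAt E F).symm e)) = Ψ e := by
      simp only [Ψ]
      rw [(chartAt E F).left_inv ha1, averagedChart_smul χ L F _ a (hint e heB.2)]
      change _ * Ψ e = Ψ e
      rw [heu]
      funext j
      by_cases hj : j = i
      · subst hj
        simp [torusWeight, hi]
      · simp [hj]
    have h2 := hinj ha2 heB h1
    rw [← (chartAt E F).left_inv ha1, h2]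
  have hyF := hiso ((chartAt E F).symm e)
    (by have := (heV 0).2; rwa [hcompact] at this)
    (smul_eq_of_forall_angleTorus_smul_eq hact hcompact)
  -- Isolatedness forces the point to be F, so u = 0, a contradiction.
  have hee : e = e₀ := by rw [← (chartAt E F).right_inv het, hyF]
  rw [hee, hΨ₀] at heu
  refine hu ?_
  have := congrFun heu i
  simpa using this.symm

end Linearization

/-! ### Degree count and conclusion -/

/-- The hypothesis on `k`, `m`, `r` bounds the total degree of the residue integrand by `-2k`. -/
theorem total_degree_le {k m r n s : ℕ} (hk : 0 < k) (hkm : k ≤ m)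
    (hr : (r : ℝ) * ((k : ℝ) - 1) ≤ ((m : ℝ) - 1) * (k : ℝ)) (hs : 1 < s)
    (hn : k * (k + 1) / 2 ≤ n) :
    k * (k - 1) / 2 + r * (k + 1 - s) + (k + 1) ≤ n + k * m := by
  obtain ⟨j, rfl⟩ : ∃ j, k = j + 1 := ⟨k - 1, by omega⟩
  obtain ⟨i, rfl⟩ : ∃ i, m = i + 1 := ⟨m - 1, by omega⟩
  have hr' : r * j ≤ i * (j + 1) := by
    have : (r : ℝ) * j ≤ i * (j + 1) := by simpa using hr
    exact_mod_cast this
  have h1 : r * (j + 1 + 1 - s) ≤ r * j := Nat.mul_le_mul_left _ (by omega)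
  have h2 : (j + 1) * (j + 1 + 1) / 2 = (j + 1) * j / 2 + (j + 1) := by
    rw [show (j + 1) * (j + 1 + 1) = (j + 1) * j + (j + 1) * 2 by ring,
      Nat.add_mul_div_right _ _ (by norm_num)]
  have h3 : (j + 1) * (i + 1) = i * (j + 1) + (j + 1) := by ring
  rw [Nat.add_sub_cancel]
  -- The available slack is 2(j+1), and j+2 is required.
  omega

/-- A single label has no partition with more than one block. -/
theorem pos_of_one_lt_card_parts {k : ℕ}
    (α : Finpartition (Finset.univ : Finset (Fin (k + 1)))) (hα : 1 < α.parts.card) : 0 < k := by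
  have := α.card_parts_le_card
  rw [Finset.card_univ, Fintype.card_fin] at this
  omega

end NestedHilbert

end

theorem theorem9p9 {k m r : ℕ} (hkm : k ≤ m) (hmr : m ≤ r)
    (hr : (r : ℝ) * ((k : ℝ) - 1) ≤ ((m : ℝ) - 1) * (k : ℝ))
    (d : ℕ) (lam : Fin m → ℂ) (θ : Fin r → ℂ)
    {E : Type*} [NormedAddCommGroup E] [NormedSpace ℂ E] [FiniteDimensional ℂ E]
    {M : Type*} [TopologicalSpace M] [T2Space M] [ChartedSpace E M] [IsManifold 𝓘(ℂ, E) ω M]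
    [MulAction (NestedHilbert.Torus k) M]
    (π : M → NestedHilbert.NestedProduct k)
    (hπ : NestedHilbert.IsEquivariantResolution E π)
    (F : M) (hF : NestedHilbert.IsIsolatedFixedPoint k F)
    (χ : Fin (Module.finrank ℂ E) → Fin k → ℤ) (hχ : NestedHilbert.IsTangentWeights E F χ)
    (α : Finpartition (Finset.univ : Finset (Fin (k + 1)))) (hα : 1 < α.parts.card) :
    NestedHilbert.HasIteratedResidue
      (NestedHilbert.residueIntegrand d lam θ (π F) χ α) 0 := by
  have hk := NestedHilbert.pos_of_one_lt_card_parts α hα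
  have hξ : ∀ (t : NestedHilbert.Torus k) (A : Finset (Fin (k + 1))),
      NestedHilbert.translateIdeal t (π F A).1 = (π F A).1 := fun t A => by
    rw [← hπ.equivariant t F A, hF.1 t]
  have hχ0 : ∀ i, χ i ≠ 0 :=
    NestedHilbert.tangentWeight_ne_zero hπ.action_holomorphic hF hχ
  exact NestedHilbert.hasIteratedResidue_residueIntegrand_zero hk d lam θ (π F) χ α hξ hχ0
    (NestedHilbert.total_degree_le hk hkm hr hα hπ.finrank_ge)
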